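/- A signed graph $\Gamma=(G,\sigma)$ is a finite simple graph $G$ together with a sign function $\sigma:E(G)\to\{+1,-1\}$; its adjacency matrix has $(u,v)$-entry $\sigma(uv)$ if $uv\in E(G)$ and $0$ otherwise, and its index $\lambda_1(\Gamma)$ is the largest eigenvalue of this matrix. $\Gamma$ is balanced if every cycle contains an even number of negative edges, and unbalanced otherwise. Switching at a nonempty proper subset $U$ of the vertex set reverses the signs of all edges between $U$ and its complement; we write $\Gamma\sim\Gamma'$ if a finite sequence of switchings turns $\Gamma$ into a signed graph isomorphic to $\Gamma'$. Let $t\mathcal{K}_4^-$ be the family of signed graphs that are the union of $t$ distinct copies of $K_4$, possibly sharing vertices and edges, each of which is unbalanced; $\Gamma$ is $t\mathcal{K}_4^-$-free if it contains no signed subgraph isomorphic to a member of this family. For $1\le s\le n-2$ let $\Gamma_{s,n}$ be the signed graph obtained from the all-positive complete graph on $v_1,\dots,v_{n-1}$ by adding a vertex $v_n$ joined to exactly $v_1,\dots,v_{s+1}$, where $v_1v_n$ is the only negative edge. Theorem. There is an absolute constant $N$ such that the following holds for all $n\ge N$ and all integers $t\ge 2$ for which $r=\frac{1+\sqrt{8t-7}}{2}$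 is an integer. Let $\Gamma$ be a $t\mathcal{K}_4^-$-free unbalanced signed graph of order $n$. (i) If $2\le t\le\binom{n-2}{2}$, then $\lambda_1(\Gamma)\le\lambda_1(\Gamma_{r,n})$, with equality if and only if $\Gamma\sim\Gamma_{r,n}$. (ii) If $t\ge\binom{n-2}{2}+1$, then $\lambda_1(\Gamma)\le\lambda_1(\Gamma_{n-2,n})$, with equality if and only if $\Gamma\sim\Gamma_{n-2,n}$. -/

import Mathlib

/-- A signed graph: an underlying simple graph together with a sign `±1` on each of its edges. -/
@[ext]
structure SignedGraph (V : Type*) where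
  /-- The underlying graph. -/
  graph : SimpleGraph V
  /-- The sign function on the edges; `ℤˣ = {1, -1}`. -/
  sign : graph.edgeSet → ℤˣ

namespace SignedGraph

variable {V W : Type*}

/-- The sign of the edge joining two adjacent vertices. -/
def edgeSign (Γ : SignedGraph V) {u v : V} (h : Γ.graph.Adj u v) : ℤˣ :=
  Γ.sign ⟨s(u, v), h⟩

open Classical in
/-- The adjacency matrix: the sign of the edge `uv` if `u` and `v` are adjacent, `0` otherwise. -/
noncomputable def adjMatrix (Γ : SignedGraph V) : Matrix V V ℝ :=
  Matrix.of fun u v => if h : Γ.graph.Adj u v then ((Γ.edgeSign h : ℤ) : ℝ) else 0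

open Classical in
/-- The index `λ₁(Γ)`: the largest eigenvalue of the adjacency matrix (whose spectrum is a finite
nonempty set of reals if there is at least one vertex). -/
noncomputable def index [Fintype V] (Γ : SignedGraph V) : ℝ :=
  sSup (spectrum ℝ Γ.adjMatrix)

/-- The number of negative edges along a walk. -/
def negCount (Γ : SignedGraph V) {u v : V} (w : Γ.graph.Walk u v) : ℕ :=
  w.darts.countP fun d => Γ.edgeSign d.adj = -1

/-- A signed graph is balanced if every cycle has an even number of negative edges. -/
def Balanced (Γ : SignedGraph V) : Prop :=
  ∀ (u : V) (c : Γ.graph.Walk u u), c.IsCycle → Even (Γ.negCount c)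

/-- A signed graph is unbalanced if it is not balanced. -/
def Unbalanced (Γ : SignedGraph V) : Prop := ¬ Γ.Balanced

/-- The signed subgraph induced by a set of vertices. -/
def induce (Γ : SignedGraph V) (S : Set V) : SignedGraph S where
  graph := Γ.graph.induce S
  sign e := Γ.sign ⟨e.1.map Subtype.val, by
    obtain ⟨e, he⟩ := e
    induction e with
    | h u v => exact he⟩

open Classical in
/-- Reversing the signs of all edges with exactly one end in `U`. -/
noncomputable def switch (Γ : SignedGraph V) (U : Set V) : SignedGraph V where
  graph := Γ.graph
  sign e := if (∃ u ∈ e.1, u ∈ U) ∧ (∃ v ∈ e.1, v ∉ U) then -Γ.sign e else Γ.sign e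

/-- `Γ'` arises from `Γ` by one switching, at a nonempty proper set of vertices. -/
def SwitchStep (Γ Γ' : SignedGraph V) : Prop :=
  ∃ U : Set V, U.Nonempty ∧ U ≠ Set.univ ∧ Γ' = Γ.switch U

/-- `Γ` and `Γ'` are isomorphic as signed graphs. -/
def Isomorphic (Γ : SignedGraph V) (Γ' : SignedGraph W) : Prop :=
  ∃ f : Γ.graph ≃g Γ'.graph, ∀ (u v : V) (h : Γ.graph.Adj u v),
    Γ'.edgeSign (f.map_adj_iff.2 h) = Γ.edgeSign h

/-- Switching equivalence `Γ ∼ Γ'` of signed graphs that need not have literally the same vertex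
set: a finite sequence of switchings turns `Γ` into a signed graph isomorphic to `Γ'`. -/
def SwitchingEquivalent (Γ : SignedGraph V) (Γ' : SignedGraph W) : Prop :=
  ∃ Γ'' : SignedGraph V, Relation.ReflTransGen SwitchStep Γ Γ'' ∧ Γ''.Isomorphic Γ'

/-- `Γ` contains a (not necessarily induced) signed subgraph isomorphic to `H`. -/
def Contains (Γ : SignedGraph V) (H : SignedGraph W) : Prop :=
  ∃ f : H.graph →g Γ.graph, Function.Injective f ∧
    ∀ (u v : W) (h : H.graph.Adj u v), Γ.edgeSign (f.map_adj h) = H.edgeSign h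

/-- The family `t𝒦₄⁻`: `H` is the union of `t` distinct copies of `K₄`, which may overlap, each of
them an unbalanced signed graph. -/
def IsUnionOfUnbalancedK4 (t : ℕ) (H : SignedGraph W) : Prop :=
  ∃ 𝒮 : Finset (Finset W), 𝒮.card = t ∧
    (∀ S ∈ 𝒮, H.graph.IsNClique 4 S ∧ (H.induce (S : Set W)).Unbalanced) ∧
    (∀ v : W, ∃ S ∈ 𝒮, v ∈ S) ∧
    (∀ u v : W, H.graph.Adj u v → ∃ S ∈ 𝒮, u ∈ S ∧ v ∈ S)

/-- `Γ` is `t𝒦₄⁻`-free: it contains no subgraph isomorphic to a member of `t𝒦₄⁻`. -/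
def UnbalancedK4Free (t : ℕ) (Γ : SignedGraph V) : Prop :=
  ∀ (m : ℕ) (H : SignedGraph (Fin m)), H.IsUnionOfUnbalancedK4 t → ¬ Γ.Contains H

open Classical in
/-- The signed graph `Γ_{s,n}` on `v₁, …, vₙ`, where `vᵢ` is the element `i - 1` of `Fin n`:
the vertices `v₁, …, vₙ₋₁` form a complete graph, `vₙ` is joined to `v₁, …, v_{s+1}`, and `v₁vₙ` is
the only negative edge. -/
noncomputable def extremal (s n : ℕ) : SignedGraph (Fin n) where
  graph :=
    { Adj := fun i j => i ≠ j ∧ (i.val + 1 = n → j.val ≤ s) ∧ (j.val + 1 = n → i.val ≤ s)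
      symm := ⟨fun _ _ h => ⟨h.1.symm, h.2.2, h.2.1⟩⟩
      loopless := ⟨fun _ h => h.1 rfl⟩ }
  sign e := if (∃ i ∈ e.1, i.val = 0) ∧ (∃ j ∈ e.1, j.val + 1 = n) then -1 else 1

end SignedGraph

open Matrix Finset

/-! ### Rayleigh quotients of symmetric real matrices -/

section Spectral

variable {V : Type*} [Fintype V] [DecidableEq V]

/-! Switch so that the index has a nonnegative eigenvector `x` (`index_switch_eigenvector`), and let
`B` be the switched adjacency matrix. Unbalancedness survives switching, so `B` has a negative edge
`uv` (`Unbalanced.exists_neg`); name its ends so that `x u ≤ x v`. Let `W` be the set of common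
positive neighbours of `u` and `v`, and `s` the parameter of the extremal graph. The competitor is a
pendant matrix: a positive clique on all vertices but `u`, with `u` joined negatively to `v` and
positively to `s` vertices. Its index is that of `extremal s n` (`exists_equiv_extremal`).

If `#W ≤ s`, enlarge `W` to size `s` and pass to the pendant matrix. An edge from `u` to `w` is lost
only if `vw` was not positive, and making `vw` positive pays for the loss because `x u ≤ x v`. Hence
the quadratic form does not drop (`dotProduct_mulVec_le_pendantMatrix`), and equality forces `B` to
be the pendant matrix (`eq_pendantMatrix_of_dotProduct_mulVec_eq`).

If `#W > s`, the index must be shown to be strictly smaller. Each edge inside `W` spans an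
unbalanced `K₄` with `uv`, so `W` has at most `t - 1 = s(s-1)/2` edges
(`UnbalancedK4Free.card_commonPosNeighbors_le`). A counterexample would have index above `n - 2`,
and the bound `μ² + μ ≤ 2m`, with `m` the number of positive edges, leaves at most `n - 2`
nonpositive pairs. Together these force `#W = s + 1`, with exactly `s` nonedges inside `W` and no
other nonpositive pairs at `W` (`structure_of_lt_card_commonPosNeighbors`). Filling in these
nonedges gains more than deleting one suitable edge at `u` costs (`exists_two_mul_lt_sum`), which
contradicts the index of the pendant matrix.

For large `t` take `s = n - 2`: then `#W ≤ s` always holds, and freeness plays no role. -/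

theorem Matrix.IsHermitian.exists_mulVec_eq_sSup_spectrum_smul [Nonempty V] {A : Matrix V V ℝ}
    (hA : A.IsHermitian) : ∃ x : V → ℝ, x ≠ 0 ∧ A *ᵥ x = sSup (spectrum ℝ A) • x := by
  have hmem : sSup (spectrum ℝ A) ∈ spectrum ℝ A := by
    rw [hA.spectrum_real_eq_range_eigenvalues]
    exact (Set.range_nonempty _).csSup_mem (Set.finite_range _)
  have hev : Module.End.HasEigenvalue (Matrix.toLin' A) (sSup (spectrum ℝ A)) := by
    rw [Module.End.hasEigenvalue_iff_mem_spectrum, Matrix.spectrum_toLin']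
    exact hmem
  obtain ⟨x, hx⟩ := hev.exists_hasEigenvector
  exact ⟨x, hx.2, by simpa using hx.apply_eq_smul⟩

theorem Matrix.IsHermitian.posSemidef_sSup_spectrum_smul_one_sub {A : Matrix V V ℝ}
    (hA : A.IsHermitian) : (sSup (spectrum ℝ A) • (1 : Matrix V V ℝ) - A).PosSemidef := by
  have hbdd : BddAbove (spectrum ℝ A) := by
    rw [hA.spectrum_real_eq_range_eigenvalues]
    exact (Set.finite_range _).bddAbove
  rw [Matrix.posSemidef_iff_isHermitian_and_spectrum_nonneg]
  refine ⟨(Matrix.isHermitian_one.smul (IsSelfAdjoint.all _)).sub hA, ?_⟩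
  intro a ha
  have h : sSup (spectrum ℝ A) - a ∈ spectrum ℝ A := by
    rw [← Algebra.algebraMap_eq_smul_one, ← spectrum.singleton_sub_eq] at ha
    obtain ⟨b, hb, c, hc, rfl⟩ := ha
    rw [Set.mem_singleton_iff] at hb
    subst hb
    simpa using hc
  have := le_csSup hbdd h
  show 0 ≤ a
  linarith

theorem Matrix.IsHermitian.dotProduct_mulVec_le {A : Matrix V V ℝ} (hA : A.IsHermitian)
    (x : V → ℝ) : x ⬝ᵥ (A *ᵥ x) ≤ sSup (spectrum ℝ A) * (x ⬝ᵥ x) := by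
  have h := hA.posSemidef_sSup_spectrum_smul_one_sub.dotProduct_mulVec_nonneg x
  simp only [star_trivial, sub_mulVec, smul_mulVec, one_mulVec, dotProduct_sub, dotProduct_smul,
    smul_eq_mul] at h
  linarith

/-- A zero of the quadratic form of a positive semidefinite matrix lies in its kernel. This turns
equality in the Rayleigh bound into an eigenvector equation. -/
theorem Matrix.IsHermitian.mulVec_eq_of_dotProduct_mulVec_eq {A : Matrix V V ℝ}
    (hA : A.IsHermitian) {x : V → ℝ} (hx : x ⬝ᵥ (A *ᵥ x) = sSup (spectrum ℝ A) * (x ⬝ᵥ x)) :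
    A *ᵥ x = sSup (spectrum ℝ A) • x := by
  have h := (hA.posSemidef_sSup_spectrum_smul_one_sub.dotProduct_mulVec_zero_iff x).1 (by
    simp only [star_trivial, sub_mulVec, smul_mulVec, one_mulVec, dotProduct_sub, dotProduct_smul,
      smul_eq_mul]
    linarith)
  simp only [sub_mulVec, smul_mulVec, one_mulVec] at h
  exact (sub_eq_zero.1 h).symm

end Spectral

/-! ### Pendant matrices and the comparison of quadratic forms -/

section Extremal

variable {V : Type*}

/-- A symmetric matrix with zero diagonal and entries in `{-1, 0, 1}`. -/
structure IsSignMatrix (B : Matrix V V ℝ) : Prop where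
  symm : ∀ i j, B i j = B j i
  diag : ∀ i, B i i = 0
  entries : ∀ i j, B i j = -1 ∨ B i j = 0 ∨ B i j = 1

theorem IsSignMatrix.le_one {B : Matrix V V ℝ} (hB : IsSignMatrix B) (i j : V) : B i j ≤ 1 := by
  rcases hB.entries i j with h | h | h <;> rw [h] <;> norm_num

theorem dotProduct_mulVec_eq_sum [Fintype V] (M : Matrix V V ℝ) (x : V → ℝ) :
    x ⬝ᵥ (M *ᵥ x) = ∑ i, ∑ j, x i * M i j * x j := by
  simp only [dotProduct, mulVec, Finset.mul_sum, mul_assoc]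

variable [DecidableEq V]

/-- The adjacency matrix of the signed graph in which all vertices other than `u` form an
all-positive complete graph, while `u` is joined to `v` by a negative edge and to the vertices
of `W` by positive edges. -/
def pendantMatrix (u v : V) (W : Finset V) : Matrix V V ℝ :=
  Matrix.of fun i j =>
    if i = j then 0
    else if i = u then (if j = v then -1 else if j ∈ W then 1 else 0)
    else if j = u then (if i = v then -1 else if i ∈ W then 1 else 0)
    else 1

theorem pendantMatrix_symm (u v : V) (W : Finset V) (i j : V) :
    pendantMatrix u v W i j = pendantMatrix u v W j i := by
  simp only [pendantMatrix, Matrix.of_apply]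
  split_ifs <;> simp_all

theorem pendantMatrix_isHermitian (u v : V) (W : Finset V) : (pendantMatrix u v W).IsHermitian := by
  ext i j
  simp [pendantMatrix_symm u v W j i]

theorem pendantMatrix_self (u v : V) (W : Finset V) (i : V) : pendantMatrix u v W i i = 0 := by
  simp [pendantMatrix]

theorem pendantMatrix_left (u v : V) (W : Finset V) {j : V} (hj : j ≠ u) :
    pendantMatrix u v W u j = if j = v then -1 else if j ∈ W then 1 else 0 := by
  simp [pendantMatrix, hj.symm]

theorem pendantMatrix_of_ne (u v : V) (W : Finset V) {i j : V} (hij : i ≠ j) (hi : i ≠ u)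
    (hj : j ≠ u) : pendantMatrix u v W i j = 1 := by
  simp [pendantMatrix, hij, hi, hj]

theorem pendant_inner_nonneg {B : Matrix V V ℝ} (hB : IsSignMatrix B) {u v : V} (W : Finset V)
    {x : V → ℝ} (hx : 0 ≤ x) {i j : V} (hi : i ≠ u) (hj : j ≠ u) :
    0 ≤ x i * (pendantMatrix u v W i j - B i j) * x j := by
  by_cases hij : i = j
  · subst hij
    simp [pendantMatrix_self, hB.diag]
  · rw [pendantMatrix_of_ne u v W hij hi hj]
    exact mul_nonneg (mul_nonneg (hx i) (sub_nonneg.2 (hB.le_one i j))) (hx j)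

/-- The only possible loss is a positive edge `uw` with `w ∉ W`, costing `x u * x w`. In that case
`B v w ≤ 0` is replaced by `1`, a gain of at least `x v * x w`. -/
theorem pendant_outer_nonneg {B : Matrix V V ℝ} (hB : IsSignMatrix B) {u v : V} (hne : u ≠ v)
    (W : Finset V) {x : V → ℝ} (hx : 0 ≤ x) (hle : x u ≤ x v) {w : V} (hwu : w ≠ u) (hwv : w ≠ v)
    (hw : B u w = 1 → B v w = 1 → w ∈ W) :
    0 ≤ x u * (pendantMatrix u v W u w - B u w) * x w +
        x v * (pendantMatrix u v W v w - B v w) * x w := by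
  have hxu : 0 ≤ x u := hx u
  have hxv : 0 ≤ x v := hx v
  have hxw : 0 ≤ x w := hx w
  rw [pendantMatrix_left u v W hwu, pendantMatrix_of_ne u v W hwv.symm hne.symm hwu, if_neg hwv,
    ← add_mul]
  refine mul_nonneg ?_ hxw
  split_ifs with hW
  · exact add_nonneg (mul_nonneg hxu (sub_nonneg.2 (hB.le_one _ _)))
      (mul_nonneg hxv (sub_nonneg.2 (hB.le_one _ _)))
  · rcases hB.entries u w with h1 | h1 | h1 <;> rcases hB.entries v w with h2 | h2 | h2 <;>
      rw [h1, h2] <;> first | exact absurd (hw h1 h2) hW | nlinarith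

variable [Fintype V]

theorem sum_sum_eq_of_symm {u v : V} (huv : u ≠ v) (F : V → V → ℝ) (hF : ∀ i j, F i j = F j i)
    (huu : F u u = 0) (hvv : F v v = 0) (h : F u v = 0) :
    ∑ i, ∑ j, F i j = ∑ i ∈ ({u, v} : Finset V)ᶜ, ∑ j ∈ ({u, v} : Finset V)ᶜ, F i j +
      2 * ∑ w ∈ ({u, v} : Finset V)ᶜ, (F u w + F v w) := by
  have key : ∀ i, ∑ j, F i j = F i u + F i v + ∑ j ∈ ({u, v} : Finset V)ᶜ, F i j := by
    intro i
    rw [← Finset.sum_add_sum_compl {u, v}, Finset.sum_pair huv]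
  rw [← Finset.sum_add_sum_compl {u, v}, Finset.sum_pair huv, key u, key v,
    Finset.sum_congr rfl fun i _ => key i]
  simp only [Finset.sum_add_distrib, huu, hvv, h, hF v u]
  rw [Finset.sum_congr rfl fun i _ => hF i u, Finset.sum_congr rfl fun i _ => hF i v]
  ring

/-- The change of the quadratic form of `B` when `B` is replaced by a pendant matrix. -/
theorem dotProduct_pendantMatrix_sub {B : Matrix V V ℝ} (hB : IsSignMatrix B) {u v : V}
    (huv : B u v = -1) (hne : u ≠ v) (W : Finset V) (x : V → ℝ) :
    x ⬝ᵥ (pendantMatrix u v W *ᵥ x) - x ⬝ᵥ (B *ᵥ x) =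
      ∑ i ∈ ({u, v} : Finset V)ᶜ, ∑ j ∈ ({u, v} : Finset V)ᶜ,
        x i * (pendantMatrix u v W i j - B i j) * x j +
      2 * ∑ w ∈ ({u, v} : Finset V)ᶜ, (x u * (pendantMatrix u v W u w - B u w) * x w +
        x v * (pendantMatrix u v W v w - B v w) * x w) := by
  rw [dotProduct_mulVec_eq_sum, dotProduct_mulVec_eq_sum, ← Finset.sum_sub_distrib]
  simp_rw [← Finset.sum_sub_distrib, ← sub_mul, ← mul_sub]
  refine sum_sum_eq_of_symm hne _ ?_ ?_ ?_ ?_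
  · intro i j
    rw [pendantMatrix_symm u v W i j, hB.symm i j]
    ring
  · simp [pendantMatrix_self, hB.diag]
  · simp [pendantMatrix_self, hB.diag]
  · simp [pendantMatrix_left u v W hne.symm, huv]

/-- If every common positive neighbour of the ends of the negative edge `uv` lies in `W`, then
passing to the pendant matrix does not decrease the quadratic form. -/
theorem dotProduct_mulVec_le_pendantMatrix {B : Matrix V V ℝ} (hB : IsSignMatrix B) {u v : V}
    (huv : B u v = -1) (hne : u ≠ v) (W : Finset V) {x : V → ℝ} (hx : 0 ≤ x) (hle : x u ≤ x v)
    (hW : ∀ w, B u w = 1 → B v w = 1 → w ∈ W) :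
    x ⬝ᵥ (B *ᵥ x) ≤ x ⬝ᵥ (pendantMatrix u v W *ᵥ x) := by
  rw [← sub_nonneg, dotProduct_pendantMatrix_sub hB huv hne]
  refine add_nonneg (Finset.sum_nonneg fun i hi => Finset.sum_nonneg fun j hj => ?_)
    (mul_nonneg zero_le_two (Finset.sum_nonneg fun w hw => ?_))
  · simp only [mem_compl, mem_insert, mem_singleton, not_or] at hi hj
    exact pendant_inner_nonneg hB W hx hi.1 hj.1
  · simp only [mem_compl, mem_insert, mem_singleton, not_or] at hw
    exact pendant_outer_nonneg hB hne W hx hle hw.1 hw.2 (hW w)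

/-- The difference of the two forms is a sum of nonnegative terms, so each term vanishes, and
positivity of `x` then determines the entries of `B`. The one ambiguous case is `w ∉ W` with `B u w
= 1` and `B v w = 0`, whose term is `(x v - x u) * x w`; `hlt` excludes it. -/
theorem eq_pendantMatrix_of_dotProduct_mulVec_eq {B : Matrix V V ℝ} (hB : IsSignMatrix B) {u v : V}
    (huv : B u v = -1) (hne : u ≠ v) (W : Finset V) {x : V → ℝ} (hx : ∀ i, 0 < x i)
    (hle : x u ≤ x v) (hW : ∀ w, B u w = 1 → B v w = 1 → w ∈ W)
    (hlt : ∀ w, w ≠ u → w ≠ v → w ∉ W → x u < x v)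
    (heq : x ⬝ᵥ (B *ᵥ x) = x ⬝ᵥ (pendantMatrix u v W *ᵥ x)) :
    B = pendantMatrix u v W := by
  have hx0 : 0 ≤ x := fun i => (hx i).le
  have hsub := dotProduct_pendantMatrix_sub hB huv hne W x
  rw [heq, sub_self] at hsub
  have hin : ∀ i ∈ ({u, v} : Finset V)ᶜ, ∀ j ∈ ({u, v} : Finset V)ᶜ,
      0 ≤ x i * (pendantMatrix u v W i j - B i j) * x j := by
    intro i hi j hj
    simp only [mem_compl, mem_insert, mem_singleton, not_or] at hi hj
    exact pendant_inner_nonneg hB W hx0 hi.1 hj.1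
  have hout : ∀ w ∈ ({u, v} : Finset V)ᶜ, 0 ≤ x u * (pendantMatrix u v W u w - B u w) * x w +
        x v * (pendantMatrix u v W v w - B v w) * x w := by
    intro w hw
    simp only [mem_compl, mem_insert, mem_singleton, not_or] at hw
    exact pendant_outer_nonneg hB hne W hx0 hle hw.1 hw.2 (hW w)
  have h1 := Finset.sum_nonneg fun i hi => Finset.sum_nonneg (hin i hi)
  have h2 := Finset.sum_nonneg hout
  have h1' := (Finset.sum_eq_zero_iff_of_nonneg fun i hi => Finset.sum_nonneg (hin i hi)).1
    (by linarith)
  have h2' := (Finset.sum_eq_zero_iff_of_nonneg hout).1 (by linarith)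
  have hinner : ∀ i j, i ≠ u → i ≠ v → j ≠ u → j ≠ v → B i j = pendantMatrix u v W i j := by
    intro i j hi hi' hj hj'
    have h := (Finset.sum_eq_zero_iff_of_nonneg (hin i (by simp [hi, hi']))).1
      (h1' i (by simp [hi, hi'])) j (by simp [hj, hj'])
    rcases mul_eq_zero.1 h with h | h
    · rcases mul_eq_zero.1 h with h | h
      · exact absurd h (hx i).ne'
      · exact (sub_eq_zero.1 h).symm
    · exact absurd h (hx j).ne'
  have houter : ∀ w, w ≠ u → w ≠ v →
      B u w = pendantMatrix u v W u w ∧ B v w = pendantMatrix u v W v w := by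
    intro w hwu hwv
    have h := h2' w (by simp [hwu, hwv])
    rw [← add_mul] at h
    have h := (mul_eq_zero.1 h).resolve_right (hx w).ne'
    have hxu := hx u
    have hxv := hx v
    rw [pendantMatrix_left u v W hwu, pendantMatrix_of_ne u v W hwv.symm hne.symm hwu,
      if_neg hwv] at h ⊢
    by_cases hwW : w ∈ W
    · rw [if_pos hwW] at h ⊢
      rcases hB.entries u w with e1 | e1 | e1 <;> rcases hB.entries v w with e2 | e2 | e2 <;>
        rw [e1, e2] at h <;> first | exact ⟨e1, e2⟩ | (exfalso; linarith)
    · rw [if_neg hwW] at h ⊢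
      have hlt' := hlt w hwu hwv hwW
      rcases hB.entries u w with e1 | e1 | e1 <;> rcases hB.entries v w with e2 | e2 | e2 <;>
        first
        | exact ⟨e1, e2⟩
        | exact absurd (hW w e1 e2) hwW
        | (exfalso; rw [e1, e2] at h; linarith)
  ext i j
  have hsymm := pendantMatrix_symm u v W
  have huv' : B u v = pendantMatrix u v W u v := by
    rw [huv, pendantMatrix_left u v W hne.symm, if_pos rfl]
  by_cases hij : i = j
  · subst hij
    rw [hB.diag, pendantMatrix_self]
  by_cases hiu : i = u
  · subst hiu
    by_cases hjv : j = v
    · rw [hjv, huv']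
    · exact (houter j (Ne.symm hij) hjv).1
  by_cases hiv : i = v
  · subst hiv
    by_cases hju : j = u
    · rw [hju, hB.symm, huv', hsymm]
    · exact (houter j hju (Ne.symm hij)).2
  by_cases hju : j = u
  · subst hju
    rw [hB.symm, hsymm]
    exact (houter i hiu hiv).1
  by_cases hjv : j = v
  · subst hjv
    rw [hB.symm, hsymm]
    exact (houter i hiu hiv).2
  exact hinner i j hiu hiv hju hjv

end Extremal

/-! ### Eigenvectors of pendant matrices, and an edge bound for the eigenvalue -/

section Extremal

variable {V : Type*} [DecidableEq V] [Fintype V]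

theorem pendantMatrix_mulVec_left {u v : V} (hne : u ≠ v) {W : Finset V} (hu : u ∉ W) (hv : v ∉ W)
    (x : V → ℝ) : (pendantMatrix u v W *ᵥ x) u = ∑ w ∈ W, x w - x v := by
  have h : ∀ j, pendantMatrix u v W u j * x j =
      (if j ∈ W then x j else 0) - (if j = v then x j else 0) := by
    intro j
    by_cases hju : j = u
    · subst hju
      simp [pendantMatrix_self, hu, hne]
    · rw [pendantMatrix_left u v W hju]
      by_cases hjv : j = v
      · subst hjv
        simp [hv]
      · by_cases hj : j ∈ W <;> simp [hjv, hj]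
  simp only [mulVec, dotProduct]
  rw [Finset.sum_congr rfl fun j _ => h j, Finset.sum_sub_distrib]
  simp

theorem pendantMatrix_mulVec_of_ne {u v : V} {W : Finset V} (x : V → ℝ) {i : V} (hi : i ≠ u) :
    (pendantMatrix u v W *ᵥ x) i =
      ∑ j, x j - x i - (1 - pendantMatrix u v W u i) * x u := by
  have h : ∀ j, pendantMatrix u v W i j * x j = x j - (if j = i then x j else 0) -
      (if j = u then (1 - pendantMatrix u v W u i) * x j else 0) := by
    intro j
    by_cases hju : j = u
    · subst hju
      rw [pendantMatrix_symm]
      simp [hi.symm]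
      ring
    · by_cases hij : j = i
      · subst hij
        simp [pendantMatrix_self, hju]
      · rw [pendantMatrix_of_ne u v W (Ne.symm hij) hi hju]
        simp [hij, hju]
  simp only [mulVec, dotProduct]
  rw [Finset.sum_congr rfl fun j _ => h j, Finset.sum_sub_distrib, Finset.sum_sub_distrib]
  simp

/-- A nonnegative eigenvector of a pendant matrix for an eigenvalue above `1` is positive. -/
theorem pos_of_pendantMatrix_mulVec_eq {u v : V} (hne : u ≠ v) {W : Finset V} (hu : u ∉ W)
    (hv : v ∉ W) (hW : 2 ≤ #W) {x : V → ℝ} (hx : 0 ≤ x) (hx0 : x ≠ 0) {μ : ℝ} (hμ : 1 < μ)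
    (h : pendantMatrix u v W *ᵥ x = μ • x) (i : V) : 0 < x i := by
  have hS : 0 < ∑ j, x j := by
    obtain ⟨j, hj⟩ := Function.ne_iff.1 hx0
    exact Finset.sum_pos' (fun j _ => hx j) ⟨j, mem_univ j, lt_of_le_of_ne (hx j) (Ne.symm hj)⟩
  have hl := congrFun h u
  rw [pendantMatrix_mulVec_left hne hu hv, Pi.smul_apply, smul_eq_mul] at hl
  have hr : ∀ i, i ≠ u → (μ + 1) * x i = ∑ j, x j - (1 - pendantMatrix u v W u i) * x u := by
    intro i hi
    have := congrFun h i
    rw [pendantMatrix_mulVec_of_ne x hi, Pi.smul_apply, smul_eq_mul] at this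
    linarith
  have hxu : 0 ≤ x u := hx u
  have hxv : 0 ≤ x v := hx v
  have hWS : ∑ w ∈ W, x w + x u ≤ ∑ j, x j := by
    rw [add_comm, ← Finset.sum_insert hu]
    exact Finset.sum_le_sum_of_subset_of_nonneg (subset_univ _) fun j _ _ => hx j
  -- The row of `u` gives `(μ + 1) * x u ≤ ∑ x`, and `μ > 1`. In the other rows the entry at `u`
  -- removes at most `2 * x u` from the sum.
  have h2 : 2 * x u < ∑ j, x j := by nlinarith
  have hpos : ∀ i, i ≠ u → 0 < x i := by
    intro i hi
    have h1 := hr i hi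
    have h3 : 0 ≤ 1 + pendantMatrix u v W u i := by
      rw [pendantMatrix_left u v W hi]
      split_ifs <;> norm_num
    nlinarith [mul_nonneg h3 hxu]
  by_cases hi : i = u
  · subst hi
    obtain ⟨a, ha, b, hb, hab⟩ := Finset.one_lt_card.1 hW
    have hav : a ≠ v := fun e => hv (e ▸ ha)
    have hau : a ≠ i := fun e => hu (e ▸ ha)
    have hbu : b ≠ i := fun e => hu (e ▸ hb)
    have ea := hr a hau
    have ev := hr v hne.symm
    rw [pendantMatrix_left i v W hau, if_neg hav, if_pos ha] at ea
    rw [pendantMatrix_left i v W hne.symm, if_pos rfl] at ev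
    -- This absorbs the negative term in the row of `u`: `μ * x u ≥ x a + x b - x v ≥ x b > 0`.
    have hva : x v ≤ x a := by nlinarith
    have hsum : x a + x b ≤ ∑ w ∈ W, x w := by
      rw [← Finset.sum_pair hab]
      exact Finset.sum_le_sum_of_subset_of_nonneg (by
        intro z hz
        simp only [mem_insert, mem_singleton] at hz
        rcases hz with rfl | rfl <;> assumption) fun j _ _ => hx j
    have := hpos b hbu
    by_contra hcon
    nlinarith
  · exact hpos i hi

/-- If `x u = x v`, the rows of `u` and `v` have equal values, but the row of `v` contains the
additional positive term `x w`. This supplies the strict inequality needed in the equality case. -/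
theorem ne_of_pendantMatrix_mulVec_eq {u v : V} (hne : u ≠ v) {W : Finset V} (hu : u ∉ W)
    (hv : v ∉ W) {x : V → ℝ} (hx : ∀ i, 0 < x i) {μ : ℝ}
    (h : pendantMatrix u v W *ᵥ x = μ • x) {w : V} (hwu : w ≠ u) (hwv : w ≠ v) (hw : w ∉ W) :
    x u ≠ x v := by
  intro heq
  have hl := congrFun h u
  rw [pendantMatrix_mulVec_left hne hu hv, Pi.smul_apply, smul_eq_mul] at hl
  have hr := congrFun h v
  rw [pendantMatrix_mulVec_of_ne x hne.symm, Pi.smul_apply, smul_eq_mul,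
    pendantMatrix_left u v W hne.symm, if_pos rfl] at hr
  have hsum : x u + (x v + (x w + ∑ z ∈ W, x z)) ≤ ∑ j, x j := by
    rw [← Finset.sum_insert hw, ← Finset.sum_insert (by simp [hwv.symm, hv]),
      ← Finset.sum_insert (by simp [hne, hwu.symm, hu])]
    exact Finset.sum_le_sum_of_subset_of_nonneg (subset_univ _) fun j _ _ => (hx j).le
  have := hx w
  rw [heq] at hl hr hsum
  linarith

/-- The indicator of the clique off `u` has Rayleigh quotient `n - 2`. It is not an eigenvector,
since its image at `u` is `#W - 1 > 0` while the vector vanishes there. -/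
theorem lt_sSup_spectrum_pendantMatrix {u v : V} (hne : u ≠ v) {W : Finset V} (hu : u ∉ W)
    (hv : v ∉ W) (hW : 2 ≤ #W) :
    (Fintype.card V : ℝ) - 2 < sSup (spectrum ℝ (pendantMatrix u v W)) := by
  have hH := pendantMatrix_isHermitian u v W
  set y : V → ℝ := fun i => if i = u then 0 else 1 with hy
  have hyu : y u = 0 := by simp [hy]
  have hyi : ∀ i, i ≠ u → y i = 1 := fun i hi => by simp [hy, hi]
  have hsum : ∑ j, y j = (Fintype.card V : ℝ) - 1 := by
    have : ∀ j, y j = 1 - if j = u then (1 : ℝ) else 0 := by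
      intro j
      by_cases hj : j = u <;> simp [hy, hj]
    rw [Finset.sum_congr rfl fun j _ => this j, Finset.sum_sub_distrib]
    simp
  have hyy : y ⬝ᵥ y = (Fintype.card V : ℝ) - 1 := by
    rw [← hsum]
    refine Finset.sum_congr rfl fun j _ => ?_
    by_cases hj : j = u <;> simp [hy, hj]
  have hyAy : y ⬝ᵥ (pendantMatrix u v W *ᵥ y) =
      ((Fintype.card V : ℝ) - 2) * ((Fintype.card V : ℝ) - 1) := by
    rw [← hsum, Finset.mul_sum]
    refine Finset.sum_congr rfl fun j _ => ?_
    by_cases hj : j = u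
    · rw [hj, hyu]
      ring
    · rw [pendantMatrix_mulVec_of_ne y hj, hyu, hyi j hj, hsum]
      ring
  have hcard : (1 : ℝ) < Fintype.card V := by
    exact_mod_cast Fintype.one_lt_card_iff.2 ⟨u, v, hne⟩
  have hle := hH.dotProduct_mulVec_le y
  rw [hyAy, hyy] at hle
  have hle := le_of_mul_le_mul_right hle (by linarith)
  refine lt_of_le_of_ne hle fun heq => ?_
  have h := congrFun (hH.mulVec_eq_of_dotProduct_mulVec_eq (x := y) (by rw [hyAy, hyy, heq])) u
  rw [pendantMatrix_mulVec_left hne hu hv, Pi.smul_apply, hyu, hyi v hne.symm,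
    Finset.sum_congr rfl fun w hw => hyi w (fun e => hu (e ▸ hw))] at h
  simp only [sum_const, nsmul_eq_mul, mul_one, smul_eq_mul, mul_zero] at h
  have : (2 : ℝ) ≤ #W := by exact_mod_cast hW
  linarith

/-- A nonnegative eigenvector of a sign matrix with `m` positive edges has an eigenvalue `μ` with
`μ ^ 2 + μ ≤ 2 * m`. -/
theorem IsSignMatrix.sq_add_le_sum_card {B : Matrix V V ℝ} (hB : IsSignMatrix B) {x : V → ℝ}
    (hx : 0 ≤ x) (hx0 : x ≠ 0) {μ : ℝ} (hμ : 0 ≤ μ) (h : B *ᵥ x = μ • x) :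
    μ ^ 2 + μ ≤ ∑ i, (#{j | B i j = 1} : ℝ) := by
  set X : ℝ := ∑ i, x i ^ 2 with hX
  have hXpos : 0 < X := by
    obtain ⟨j, hj⟩ := Function.ne_iff.1 hx0
    exact Finset.sum_pos' (fun j _ => sq_nonneg _) ⟨j, mem_univ j, by
      have : x j ≠ 0 := hj
      positivity⟩
  have hrow : ∀ i, μ * x i ≤ ∑ j with B i j = 1, x j := by
    intro i
    have hi := congrFun h i
    rw [Pi.smul_apply, smul_eq_mul] at hi
    rw [← hi, Finset.sum_filter]
    refine Finset.sum_le_sum fun j _ => ?_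
    have hxj : 0 ≤ x j := hx j
    change B i j * x j ≤ _
    rcases hB.entries i j with e | e | e <;> rw [e] <;> norm_num
    exact hxj
  -- Cauchy–Schwarz over the positive neighbours of `i`. Since `i` is not among them, `x i ^ 2` can
  -- be subtracted; summed over `i`, this correction supplies the linear term in `μ` through `hlin`.
  have hsq : ∀ i, (μ * x i) ^ 2 ≤ (#{j | B i j = 1} : ℝ) * (X - x i ^ 2) := by
    intro i
    have h1 : (μ * x i) ^ 2 ≤ (∑ j with B i j = 1, x j) ^ 2 :=
      pow_le_pow_left₀ (mul_nonneg hμ (hx i)) (hrow i) 2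
    refine h1.trans (sq_sum_le_card_mul_sum_sq.trans ?_)
    refine mul_le_mul_of_nonneg_left ?_ (Nat.cast_nonneg _)
    rw [hX, ← Finset.sum_erase_eq_sub (mem_univ i)]
    refine Finset.sum_le_sum_of_subset_of_nonneg ?_ fun j _ _ => sq_nonneg _
    intro j hj
    simp only [mem_filter, mem_univ, true_and] at hj
    refine mem_erase.2 ⟨?_, mem_univ j⟩
    rintro rfl
    rw [hB.diag] at hj
    norm_num at hj
  have hlin : μ * X ≤ ∑ i, (#{j | B i j = 1} : ℝ) * x i ^ 2 := by
    have h1 : μ * X ≤ ∑ i, ∑ j with B i j = 1, (x i ^ 2 + x j ^ 2) / 2 := by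
      rw [hX, Finset.mul_sum]
      refine Finset.sum_le_sum fun i _ => ?_
      have := mul_le_mul_of_nonneg_left (hrow i) (hx i)
      rw [Finset.mul_sum] at this
      calc μ * x i ^ 2 = x i * (μ * x i) := by ring
        _ ≤ _ := this
        _ ≤ _ := Finset.sum_le_sum fun j _ => by nlinarith [sq_nonneg (x i - x j)]
    have h2 : ∑ i, ∑ j with B i j = 1, x j ^ 2 = ∑ i, ∑ j with B i j = 1, x i ^ 2 := by
      simp_rw [Finset.sum_filter]
      rw [Finset.sum_comm]
      exact Finset.sum_congr rfl fun i _ => Finset.sum_congr rfl fun j _ => by rw [hB.symm]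
    have h3 : ∑ i, ∑ j with B i j = 1, (x i ^ 2 + x j ^ 2) / 2 =
        ∑ i, ∑ j with B i j = 1, x i ^ 2 := by
      simp_rw [← Finset.sum_div, Finset.sum_add_distrib]
      rw [h2]
      ring
    rw [h3] at h1
    simpa using h1
  have hquad : μ ^ 2 * X ≤ (∑ i, (#{j | B i j = 1} : ℝ)) * X -
      ∑ i, (#{j | B i j = 1} : ℝ) * x i ^ 2 := by
    rw [hX, Finset.mul_sum, ← hX, Finset.sum_mul, ← Finset.sum_sub_distrib]
    refine Finset.sum_le_sum fun i _ => ?_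
    have := hsq i
    nlinarith
  refine le_of_mul_le_mul_right ?_ hXpos
  nlinarith

end Extremal

/-! ### Counting nonpositive pairs, and the bound for sign matrices -/

section Extremal

variable {V : Type*} [Fintype V]

/-- The common neighbours of `u` and `v` along positive edges. -/
noncomputable def commonPosNeighbors (B : Matrix V V ℝ) (u v : V) : Finset V :=
  {w | B u w = 1 ∧ B v w = 1}

theorem mem_commonPosNeighbors {B : Matrix V V ℝ} {u v w : V} :
    w ∈ commonPosNeighbors B u v ↔ B u w = 1 ∧ B v w = 1 := by
  simp [commonPosNeighbors]

theorem IsSignMatrix.left_notMem_commonPosNeighbors {B : Matrix V V ℝ} (hB : IsSignMatrix B)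
    (u v : V) : u ∉ commonPosNeighbors B u v := by
  simp [mem_commonPosNeighbors, hB.diag]

theorem IsSignMatrix.right_notMem_commonPosNeighbors {B : Matrix V V ℝ} (hB : IsSignMatrix B)
    (u v : V) : v ∉ commonPosNeighbors B u v := by
  simp [mem_commonPosNeighbors, hB.diag]

variable [DecidableEq V]

/-- The vertices that are not joined to `i` by a positive edge. -/
noncomputable def nonposNeighbors (B : Matrix V V ℝ) (i : V) : Finset V := {j | j ≠ i ∧ B i j ≠ 1}

theorem mem_nonposNeighbors {B : Matrix V V ℝ} {i j : V} :
    j ∈ nonposNeighbors B i ↔ j ≠ i ∧ B i j ≠ 1 := by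
  simp [nonposNeighbors]

theorem IsSignMatrix.even_sum_card_nonposNeighbors {B : Matrix V V ℝ} (hB : IsSignMatrix B) :
    Even (∑ i, #(nonposNeighbors B i)) := by
  classical
  let G : SimpleGraph V :=
    { Adj := fun i j => j ≠ i ∧ B i j ≠ 1
      symm := ⟨fun i j h => ⟨h.1.symm, by rw [hB.symm]; exact h.2⟩⟩
      loopless := ⟨fun i h => h.1 rfl⟩ }
  have h : ∑ i, #(nonposNeighbors B i) = ∑ i, G.degree i := by
    refine Finset.sum_congr rfl fun i _ => ?_
    rw [← SimpleGraph.card_neighborFinset_eq_degree]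
    congr 1
    ext j
    simp [mem_nonposNeighbors, G]
  rw [h, G.sum_degrees_eq_twice_card_edges]
  exact even_two_mul _

theorem IsSignMatrix.card_add_card_nonposNeighbors {B : Matrix V V ℝ} (hB : IsSignMatrix B)
    (i : V) : #{j | B i j = 1} + #(nonposNeighbors B i) + 1 = Fintype.card V := by
  have h1 : #{j | B i j ≠ 1} = #(nonposNeighbors B i) + 1 := by
    rw [← Finset.card_insert_of_notMem (a := i) (by simp [mem_nonposNeighbors])]
    congr 1
    ext j
    by_cases hj : j = i <;> simp [mem_nonposNeighbors, hj, hB.diag]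
  rw [add_assoc, ← h1, ← Finset.card_univ]
  exact Finset.card_filter_add_card_filter_not _

/-- From `μ > n - 2` there are more than `(n - 2)(n - 1)` ordered positive pairs, hence fewer than
`2n - 2` ordered nonpositive ones. Their number is even, so it is at most `2n - 4`. -/
theorem IsSignMatrix.sum_card_nonposNeighbors_le {B : Matrix V V ℝ} (hB : IsSignMatrix B)
    {x : V → ℝ} (hx : 0 ≤ x) (hx0 : x ≠ 0) {μ : ℝ} (hn : 2 ≤ Fintype.card V)
    (hμ : (Fintype.card V : ℝ) - 2 < μ) (h : B *ᵥ x = μ • x) :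
    ∑ i, #(nonposNeighbors B i) + 4 ≤ 2 * Fintype.card V := by
  have hn' : (2 : ℝ) ≤ Fintype.card V := by exact_mod_cast hn
  have h1 := hB.sq_add_le_sum_card hx hx0 (by linarith) h
  have h2 : (∑ i, (#{j | B i j = 1} : ℝ)) + (∑ i, #(nonposNeighbors B i) : ℕ) + Fintype.card V =
      (Fintype.card V : ℝ) * Fintype.card V := by
    have : ∑ i : V, (#{j | B i j = 1} + #(nonposNeighbors B i) + 1) =
        Fintype.card V * Fintype.card V := by
      rw [Finset.sum_congr rfl fun i _ => hB.card_add_card_nonposNeighbors i]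
      simp
    rw [Finset.sum_add_distrib, Finset.sum_add_distrib] at this
    simp only [sum_const, card_univ, smul_eq_mul, mul_one] at this
    exact_mod_cast this
  have h3 : ((∑ i, #(nonposNeighbors B i) : ℕ) : ℝ) < 2 * Fintype.card V - 2 := by nlinarith
  have h4 : ∑ i, #(nonposNeighbors B i) + 2 < 2 * Fintype.card V := by
    have : ((∑ i, #(nonposNeighbors B i) : ℕ) : ℝ) + 2 < 2 * Fintype.card V := by linarith
    exact_mod_cast this
  obtain ⟨m, hm⟩ := hB.even_sum_card_nonposNeighbors
  omega

/-- If the ends of a negative edge have more than `s` common positive neighbours, then few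
nonpositive pairs force exactly `s + 1` of them, and the nonpositive pairs at these are nonedges
among them. -/
theorem IsSignMatrix.structure_of_lt_card_commonPosNeighbors {B : Matrix V V ℝ}
    (hB : IsSignMatrix B) {u v : V} (huv : B u v = -1) (hne : u ≠ v) {s : ℕ} (hs : 1 ≤ s)
    (hle : ∑ i, #(nonposNeighbors B i) + 4 ≤ 2 * Fintype.card V)
    (hlt : s < #(commonPosNeighbors B u v))
    (hcount : #(commonPosNeighbors B u v) * (#(commonPosNeighbors B u v) - 1) ≤ s * (s - 1) +
      ∑ w ∈ commonPosNeighbors B u v, #{z ∈ commonPosNeighbors B u v | z ≠ w ∧ B w z = 0}) :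
    #(commonPosNeighbors B u v) = s + 1 ∧
      (∑ w ∈ commonPosNeighbors B u v, #(nonposNeighbors B w) = 2 * s) ∧
      ∀ w ∈ commonPosNeighbors B u v, ∀ z ∈ nonposNeighbors B w,
        z ∈ commonPosNeighbors B u v ∧ B w z = 0 := by
  set W := commonPosNeighbors B u v with hW
  have hu : u ∉ W := hB.left_notMem_commonPosNeighbors u v
  have hv : v ∉ W := hB.right_notMem_commonPosNeighbors u v
  have hvu : B v u = -1 := by rw [hB.symm, huv]
  -- Every vertex outside `W` is paired nonpositively with `u` or `v`. With `k = #W`, this accounts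
  -- for at least `n - k` of the sum at `u` and `v`, and at least one more at each of the other `n -
  -- k - 2` vertices outside `W`.
  have hsub : Wᶜ ⊆ nonposNeighbors B u ∪ nonposNeighbors B v := by
    intro w hw
    rw [mem_compl, hW, mem_commonPosNeighbors, not_and_or] at hw
    rw [mem_union, mem_nonposNeighbors, mem_nonposNeighbors]
    by_cases hwu : w = u
    · subst hwu
      exact Or.inr ⟨hne, by rw [hvu]; norm_num⟩
    · by_cases hwv : w = v
      · subst hwv
        exact Or.inl ⟨hne.symm, by rw [huv]; norm_num⟩
      · rcases hw with h | h
        · exact Or.inl ⟨hwu, h⟩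
        · exact Or.inr ⟨hwv, h⟩
  have hc1 : #Wᶜ ≤ #(nonposNeighbors B u) + #(nonposNeighbors B v) :=
    (card_le_card hsub).trans (card_union_le _ _)
  have hpair : ({u, v} : Finset V) ⊆ Wᶜ := by
    intro z hz
    simp only [mem_insert, mem_singleton] at hz
    rcases hz with rfl | rfl <;> simpa
  have hc2 : #(Wᶜ \ {u, v}) ≤ ∑ w ∈ Wᶜ \ {u, v}, #(nonposNeighbors B w) := by
    rw [Finset.card_eq_sum_ones]
    refine Finset.sum_le_sum fun w hw => ?_
    have hw' := hsub (mem_sdiff.1 hw).1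
    refine Finset.card_pos.2 ?_
    rw [mem_union, mem_nonposNeighbors, mem_nonposNeighbors] at hw'
    rcases hw' with h | h
    · exact ⟨u, mem_nonposNeighbors.2 ⟨h.1.symm, by rw [hB.symm]; exact h.2⟩⟩
    · exact ⟨v, mem_nonposNeighbors.2 ⟨h.1.symm, by rw [hB.symm]; exact h.2⟩⟩
  have hc3 : #(Wᶜ \ {u, v}) + 2 = #Wᶜ := by
    rw [← Finset.card_pair hne]
    exact Finset.card_sdiff_add_card_eq_card hpair
  have hc4 : #Wᶜ + #W = Fintype.card V := by
    rw [add_comm, Finset.card_add_card_compl]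
  have hsplit : ∑ w ∈ W, #(nonposNeighbors B w) + (∑ w ∈ Wᶜ \ {u, v}, #(nonposNeighbors B w) +
      (#(nonposNeighbors B u) + #(nonposNeighbors B v))) = ∑ w, #(nonposNeighbors B w) := by
    rw [← Finset.sum_add_sum_compl W, ← Finset.sum_sdiff hpair, Finset.sum_pair hne]
  -- What remains for `W` is `(2n - 4) - (n - k) - (n - k - 2) = 2k - 2`.
  have hWle : ∑ w ∈ W, #(nonposNeighbors B w) + 2 ≤ 2 * #W := by omega
  have hincl : ∀ w ∈ W, ({z ∈ W | z ≠ w ∧ B w z = 0} : Finset V) ⊆ nonposNeighbors B w := by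
    intro w _ z hz
    rw [mem_filter] at hz
    rw [mem_nonposNeighbors]
    exact ⟨hz.2.1, by rw [hz.2.2]; norm_num⟩
  have hterm : ∀ w ∈ W, #({z ∈ W | z ≠ w ∧ B w z = 0} : Finset V) ≤ #(nonposNeighbors B w) :=
    fun w hw => card_le_card (hincl w hw)
  have hsum := Finset.sum_le_sum hterm
  obtain ⟨d, hd⟩ : ∃ d, #W = s + 1 + d := ⟨#W - (s + 1), by omega⟩
  obtain ⟨s', rfl⟩ : ∃ s', s = s' + 1 := ⟨s - 1, by omega⟩
  rw [hd] at hcount hWle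
  simp only [Nat.add_sub_cancel] at hcount
  have hpred : s' + 1 + 1 + d - 1 = s' + 1 + d := by omega
  rw [hpred] at hcount
  -- Combining `hcount` with `hWle` gives `(k - 1)(k - 2) ≤ s(s - 1)`, so `k ≤ s + 1`. When `k = s +
  -- 1` this is an equality, so both intermediate estimates are tight.
  have hd0 : d = 0 := by
    by_contra hcon
    have : 1 ≤ d := by omega
    nlinarith
  subst hd0
  have heq1 : ∑ w ∈ W, #(nonposNeighbors B w) = 2 * (s' + 1) := by nlinarith
  have heq2 : ∑ w ∈ W, #({z ∈ W | z ≠ w ∧ B w z = 0} : Finset V) =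
      ∑ w ∈ W, #(nonposNeighbors B w) := by nlinarith
  refine ⟨by omega, heq1, fun w hw z hz => ?_⟩
  have h := (Finset.sum_eq_sum_iff_of_le hterm).1 heq2 w hw
  rw [← Finset.eq_of_subset_of_card_le (hincl w hw) h.ge, mem_filter] at hz
  exact ⟨hz.1, hz.2.2⟩

theorem IsSignMatrix.mulVec_eq_sub_of_forall {B : Matrix V V ℝ} (hB : IsSignMatrix B) (x : V → ℝ)
    {w : V} (hw : ∀ z ∈ nonposNeighbors B w, B w z = 0) :
    (B *ᵥ x) w = ∑ j, x j - x w - ∑ z ∈ nonposNeighbors B w, x z := by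
  have h : ∀ j, B w j * x j = x j - (if j = w then x j else 0) -
      (if j ∈ nonposNeighbors B w then x j else 0) := by
    intro j
    by_cases hj : j = w
    · subst hj
      simp [hB.diag, mem_nonposNeighbors]
    · by_cases hj' : j ∈ nonposNeighbors B w
      · simp [hw j hj', hj, hj']
      · have : B w j = 1 := by
          by_contra hcon
          exact hj' (mem_nonposNeighbors.2 ⟨hj, hcon⟩)
        simp [this, hj, hj']
  simp only [mulVec, dotProduct]
  rw [Finset.sum_congr rfl fun j _ => h j, Finset.sum_sub_distrib, Finset.sum_sub_distrib]
  simp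

theorem IsSignMatrix.mulVec_le_sub {B : Matrix V V ℝ} (hB : IsSignMatrix B) {x : V → ℝ}
    (hx : 0 ≤ x) (i : V) : (B *ᵥ x) i ≤ ∑ j, x j - x i := by
  have h : ∑ j, (if j = i then x j else 0) = x i := by simp
  rw [← h, ← Finset.sum_sub_distrib]
  refine Finset.sum_le_sum fun j _ => ?_
  change B i j * x j ≤ _
  have hxj : 0 ≤ x j := hx j
  by_cases hj : j = i
  · subst hj
    simp [hB.diag]
  · rw [if_neg hj, sub_zero]
    exact mul_le_of_le_one_left hxj (hB.le_one i j)

/-- The gain from filling in the missing edges among the common positive neighbours of `u` and `v`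
while deleting the edge from `u` to one of them. -/
theorem IsSignMatrix.add_sum_le_pendantMatrix_erase {B : Matrix V V ℝ} (hB : IsSignMatrix B)
    {u v : V} (huv : B u v = -1) (hne : u ≠ v) {x : V → ℝ} (hx : 0 ≤ x) (hle : x u ≤ x v)
    (hD : ∀ w ∈ commonPosNeighbors B u v, ∀ z ∈ nonposNeighbors B w,
        z ∈ commonPosNeighbors B u v ∧ B w z = 0)
    {a : V} (ha : a ∈ commonPosNeighbors B u v) :
    x ⬝ᵥ (B *ᵥ x) +
      (∑ w ∈ commonPosNeighbors B u v, ∑ z ∈ nonposNeighbors B w, x w * x z - 2 * (x u * x a)) ≤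
      x ⬝ᵥ (pendantMatrix u v ((commonPosNeighbors B u v).erase a) *ᵥ x) := by
  set W := commonPosNeighbors B u v with hW
  have hu : u ∉ W := hB.left_notMem_commonPosNeighbors u v
  have hv : v ∉ W := hB.right_notMem_commonPosNeighbors u v
  have hsub := dotProduct_pendantMatrix_sub hB huv hne (W.erase a) x
  have hWsub : W ⊆ ({u, v} : Finset V)ᶜ := by
    intro z hz
    simp only [mem_compl, mem_insert, mem_singleton, not_or]
    exact ⟨fun e => hu (e ▸ hz), fun e => hv (e ▸ hz)⟩
  have hin : ∀ i ∈ ({u, v} : Finset V)ᶜ, ∀ j ∈ ({u, v} : Finset V)ᶜ,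
      0 ≤ x i * (pendantMatrix u v (W.erase a) i j - B i j) * x j := by
    intro i hi j hj
    simp only [mem_compl, mem_insert, mem_singleton, not_or] at hi hj
    exact pendant_inner_nonneg hB _ hx hi.1 hj.1
  have h1 : ∑ w ∈ W, ∑ z ∈ nonposNeighbors B w, x w * x z ≤
      ∑ i ∈ ({u, v} : Finset V)ᶜ, ∑ j ∈ ({u, v} : Finset V)ᶜ,
        x i * (pendantMatrix u v (W.erase a) i j - B i j) * x j := by
    refine (Finset.sum_le_sum fun w hw => ?_).trans
      (Finset.sum_le_sum_of_subset_of_nonneg hWsub fun i hi _ => Finset.sum_nonneg (hin i hi))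
    have hsubset : nonposNeighbors B w ⊆ ({u, v} : Finset V)ᶜ := fun z hz =>
      hWsub (hD w hw z hz).1
    refine le_trans (le_of_eq (Finset.sum_congr rfl fun z hz => ?_))
      (Finset.sum_le_sum_of_subset_of_nonneg hsubset fun j hj _ => hin w (hWsub hw) j hj)
    have hwu : w ≠ u := fun e => hu (e ▸ hw)
    have hzu : z ≠ u := fun e => hu (e ▸ (hD w hw z hz).1)
    rw [pendantMatrix_of_ne u v _ (mem_nonposNeighbors.1 hz).1.symm hwu hzu, (hD w hw z hz).2]
    ring
  have hau : a ≠ u := fun e => hu (e ▸ ha)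
  have hav : a ≠ v := fun e => hv (e ▸ ha)
  have h2 : -(x u * x a) ≤ ∑ w ∈ ({u, v} : Finset V)ᶜ,
      (x u * (pendantMatrix u v (W.erase a) u w - B u w) * x w +
        x v * (pendantMatrix u v (W.erase a) v w - B v w) * x w) := by
    rw [← Finset.add_sum_erase _ _ (hWsub ha)]
    have hB' := mem_commonPosNeighbors.1 ha
    have e : x u * (pendantMatrix u v (W.erase a) u a - B u a) * x a +
        x v * (pendantMatrix u v (W.erase a) v a - B v a) * x a = -(x u * x a) := by
      rw [pendantMatrix_left u v _ hau, if_neg hav, if_neg (by simp),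
        pendantMatrix_of_ne u v _ hav.symm hne.symm hau, hB'.1, hB'.2]
      ring
    rw [e]
    refine le_add_of_nonneg_right (Finset.sum_nonneg fun w hw => ?_)
    simp only [mem_erase, mem_compl, mem_insert, mem_singleton, not_or] at hw
    refine pendant_outer_nonneg hB hne _ hx hle hw.2.1 hw.2.2 fun e1 e2 => ?_
    exact mem_erase.2 ⟨hw.1, mem_commonPosNeighbors.2 ⟨e1, e2⟩⟩
  linarith

/-- The missing edges among the common positive neighbours of `u` and `v` outweigh one edge
at `u`. -/
theorem IsSignMatrix.exists_two_mul_lt_sum {B : Matrix V V ℝ}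
    (hB : IsSignMatrix B) (hn : 9 ≤ Fintype.card V) {x : V → ℝ} (hx : 0 ≤ x) (hx0 : x ≠ 0) {μ : ℝ}
    (hμ : (Fintype.card V : ℝ) - 2 < μ) (h : B *ᵥ x = μ • x) {s : ℕ} (hs : 2 ≤ s)
    (hsn : s + 3 ≤ Fintype.card V) (u : V) {W : Finset V} (hW : #W = s + 1)
    (hδ : ∑ w ∈ W, #(nonposNeighbors B w) = 2 * s)
    (hD : ∀ w ∈ W, ∀ z ∈ nonposNeighbors B w, z ∈ W ∧ B w z = 0) :
    ∃ a ∈ W, 2 * (x u * x a) < ∑ w ∈ W, ∑ z ∈ nonposNeighbors B w, x w * x z := by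
  have hn' : (9 : ℝ) ≤ Fintype.card V := by exact_mod_cast hn
  set n : ℝ := (Fintype.card V : ℝ) with hndef
  have hS : 0 < ∑ j, x j := by
    obtain ⟨j, hj⟩ := Function.ne_iff.1 hx0
    exact Finset.sum_pos' (fun j _ => hx j) ⟨j, mem_univ j, lt_of_le_of_ne (hx j) (Ne.symm hj)⟩
  -- `T` is the value of `x` at a vertex joined positively to all others. It bounds every coordinate
  -- from above, and a vertex of `W` with `d` missing edges has coordinate at least `T * (1 - d / (n
  -- - 1))`.
  obtain ⟨T, hT⟩ : ∃ T, T * (μ + 1) = ∑ j, x j := ⟨(∑ j, x j) / (μ + 1), by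
    have : μ + 1 ≠ 0 := by linarith
    field_simp⟩
  have hTpos : 0 < T := by
    by_contra hcon
    nlinarith
  have hxT : ∀ i, x i ≤ T := by
    intro i
    have h1 := hB.mulVec_le_sub hx i
    rw [h, Pi.smul_apply, smul_eq_mul, ← hT] at h1
    refine le_of_mul_le_mul_right (a := μ + 1) ?_ (by linarith)
    linarith
  have hlow : ∀ w ∈ W, T * (n - 1 - #(nonposNeighbors B w)) ≤ (n - 1) * x w := by
    intro w hw
    have h1 := hB.mulVec_eq_sub_of_forall x fun z hz => (hD w hw z hz).2
    rw [h, Pi.smul_apply, smul_eq_mul, ← hT] at h1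
    have h2 : ∑ z ∈ nonposNeighbors B w, x z ≤ #(nonposNeighbors B w) * T := by
      rw [← nsmul_eq_mul]
      exact Finset.sum_le_card_nsmul _ _ _ fun z _ => hxT z
    have h3 := hxT w
    nlinarith
  have hsn' : (s : ℝ) + 3 ≤ Fintype.card V := by exact_mod_cast hsn
  have hs' : (2 : ℝ) ≤ s := by exact_mod_cast hs
  have hWne : W.Nonempty := Finset.card_pos.1 (by omega)
  have hxu : 0 ≤ x u := hx u
  obtain ⟨a, ha, hmax⟩ := Finset.exists_max_image W (fun w => #(nonposNeighbors B w)) hWne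
  -- If some vertex of `W` misses at least three edges, those edges alone outweigh the edge from `u`
  -- to it. Otherwise all coordinates on `W` are close to `T`, and the smallest one is used.
  by_cases hbig : 3 ≤ #(nonposNeighbors B a)
  · refine ⟨a, ha, ?_⟩
    have hDa : nonposNeighbors B a ⊆ W.erase a := fun z hz =>
      mem_erase.2 ⟨(mem_nonposNeighbors.1 hz).1, (hD a ha z hz).1⟩
    have has : #(nonposNeighbors B a) ≤ s := by
      have := card_le_card hDa
      rw [card_erase_of_mem ha, hW] at this
      omega
    have has' : (#(nonposNeighbors B a) : ℝ) ≤ s := by exact_mod_cast has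
    have hbig' : (3 : ℝ) ≤ #(nonposNeighbors B a) := by exact_mod_cast hbig
    have hxa : 0 < x a := by
      have := hlow a ha
      have h1 : 0 < T * (n - 1 - #(nonposNeighbors B a)) := mul_pos hTpos (by linarith)
      by_contra hcon
      nlinarith
    set y : ℝ := ∑ z ∈ nonposNeighbors B a, x z with hy
    have hrest : ∑ z ∈ nonposNeighbors B a, #(nonposNeighbors B z) + #(nonposNeighbors B a) ≤
        2 * s := by
      rw [← hδ, ← Finset.sum_erase_add _ _ ha]
      exact Nat.add_le_add_right (Finset.sum_le_sum_of_subset hDa) _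
    -- The degrees in the missing graph sum to `2s`, so those of the nonneighbours of `a` sum to at
    -- most `2s - d`, with `d` the degree of `a`. Then `(n - 1) * y ≥ T * (d * (n - 1) - (2s - d))`,
    -- which exceeds `T * (n - 1)` because `d ≥ 3` and `s ≤ n - 3`.
    have hylow : T < y := by
      have h1 : ∑ z ∈ nonposNeighbors B a, T * (n - 1 - #(nonposNeighbors B z)) ≤
          ∑ z ∈ nonposNeighbors B a, (n - 1) * x z :=
        Finset.sum_le_sum fun z hz => hlow z (hD a ha z hz).1
      rw [← Finset.mul_sum, ← Finset.mul_sum, ← hy, Finset.sum_sub_distrib, Finset.sum_const,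
        nsmul_eq_mul] at h1
      have h2 : (∑ z ∈ nonposNeighbors B a, (#(nonposNeighbors B z) : ℝ)) +
          #(nonposNeighbors B a) ≤ 2 * s := by exact_mod_cast hrest
      have h3 : n - 1 < #(nonposNeighbors B a) * (n - 1) -
          ∑ z ∈ nonposNeighbors B a, (#(nonposNeighbors B z) : ℝ) := by nlinarith
      have h4 := mul_lt_mul_of_pos_left h3 hTpos
      by_contra hcon
      nlinarith
    -- Each missing edge at `a` is counted once from `a` and once from its other end.
    have hge : 2 * (x a * y) ≤ ∑ w ∈ W, ∑ z ∈ nonposNeighbors B w, x w * x z := by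
      rw [← Finset.add_sum_erase _ _ ha, ← Finset.mul_sum, two_mul]
      refine add_le_add le_rfl ?_
      refine le_trans ?_ (Finset.sum_le_sum_of_subset_of_nonneg hDa fun w _ _ =>
        Finset.sum_nonneg fun z _ => mul_nonneg (hx w) (hx z))
      rw [hy, Finset.mul_sum]
      refine Finset.sum_le_sum fun w hw => ?_
      rw [mul_comm]
      refine Finset.single_le_sum (f := fun z => x w * x z)
        (fun z _ => mul_nonneg (hx w) (hx z)) ?_
      have := mem_nonposNeighbors.1 hw
      exact mem_nonposNeighbors.2 ⟨this.1.symm, by rw [hB.symm]; exact this.2⟩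
    have := hxT u
    nlinarith
  · obtain ⟨b, hb, hmin⟩ := Finset.exists_min_image W x hWne
    refine ⟨b, hb, ?_⟩
    -- At most two missing edges at `b` and `n ≥ 9` give `2 / (n - 1) ≤ 1 / 4`. With `s ≥ 2` the
    -- gain is then at least `4 * x b ^ 2 ≥ 3 * T * x b`, more than `2 * x u * x b`.
    have hxb : 3 / 4 * T ≤ x b := by
      have h1 := hlow b hb
      have h2 : #(nonposNeighbors B b) ≤ 2 := (hmax b hb).trans (by omega)
      have h2' : (#(nonposNeighbors B b) : ℝ) ≤ 2 := by exact_mod_cast h2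
      have h3 : 3 / 4 * (n - 1) ≤ n - 1 - #(nonposNeighbors B b) := by linarith
      have h4 := mul_le_mul_of_nonneg_left h3 hTpos.le
      refine le_of_mul_le_mul_left (a := n - 1) ?_ (by linarith)
      linarith
    have hbpos : 0 < x b := by linarith
    have hge : 2 * s * (x b * x b) ≤ ∑ w ∈ W, ∑ z ∈ nonposNeighbors B w, x w * x z := by
      have h1 : (2 * s * (x b * x b) : ℝ) = ∑ w ∈ W, ∑ z ∈ nonposNeighbors B w, x b * x b := by
        simp only [sum_const, nsmul_eq_mul]
        rw [← Finset.sum_mul]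
        have : (∑ w ∈ W, (#(nonposNeighbors B w) : ℝ)) = 2 * s := by exact_mod_cast hδ
        rw [this]
      rw [h1]
      exact Finset.sum_le_sum fun w hw => Finset.sum_le_sum fun z hz =>
        mul_le_mul (hmin w hw) (hmin z (hD w hw z hz).1) hbpos.le (hx w)
    have h1 : 4 * (x b * x b) ≤ 2 * s * (x b * x b) :=
      mul_le_mul_of_nonneg_right (by linarith) (by positivity)
    have := hxT u
    nlinarith

/-- Let `B` be a sign matrix with a negative edge `uv`, in which the ends of a negative edge
have few complete pairs of common positive neighbours. Then an eigenvalue of `B` with a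
nonnegative eigenvector is at most the index `κ` of the pendant matrices with `s` positive edges at
the pendant vertex, with equality only if `B` is such a pendant matrix. -/
theorem IsSignMatrix.eigenvalue_le {B : Matrix V V ℝ} (hB : IsSignMatrix B)
    (hn : 9 ≤ Fintype.card V) {x : V → ℝ} (hx : 0 ≤ x) (hx0 : x ≠ 0) {μ : ℝ}
    (h : B *ᵥ x = μ • x) {u v : V} (huv : B u v = -1) {s : ℕ} (hs : 2 ≤ s)
    (hsn : s + 2 ≤ Fintype.card V)
    (hcount : ∀ u v, B u v = -1 → s < #(commonPosNeighbors B u v) →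
      #(commonPosNeighbors B u v) * (#(commonPosNeighbors B u v) - 1) ≤ s * (s - 1) +
      ∑ w ∈ commonPosNeighbors B u v, #{z ∈ commonPosNeighbors B u v | z ≠ w ∧ B w z = 0})
    {κ : ℝ} (hκ : ∀ (u v : V) (W : Finset V), u ≠ v → u ∉ W → v ∉ W → #W = s →
      sSup (spectrum ℝ (pendantMatrix u v W)) = κ) :
    μ ≤ κ ∧ (μ = κ → ∃ (u v : V) (W : Finset V), u ≠ v ∧ u ∉ W ∧ v ∉ W ∧ #W = s ∧
      B = pendantMatrix u v W) := by
  have hne : u ≠ v := by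
    rintro rfl
    rw [hB.diag] at huv
    norm_num at huv
  wlog hle : x u ≤ x v generalizing u v
  · exact this (u := v) (v := u) (by rw [hB.symm, huv]) hne.symm (le_of_not_ge hle)
  have hxx : 0 < x ⬝ᵥ x := by
    refine lt_of_le_of_ne (Finset.sum_nonneg fun i _ => mul_self_nonneg _) fun e => hx0 ?_
    exact dotProduct_self_eq_zero.1 e.symm
  have hμx : x ⬝ᵥ (B *ᵥ x) = μ * (x ⬝ᵥ x) := by
    rw [h, dotProduct_smul, smul_eq_mul]
  have hu := hB.left_notMem_commonPosNeighbors u v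
  have hv := hB.right_notMem_commonPosNeighbors u v
  have hn' : (9 : ℝ) ≤ Fintype.card V := by exact_mod_cast hn
  rcases le_or_gt #(commonPosNeighbors B u v) s with hk | hk
  · obtain ⟨W, hWsub, hWsup, hWs⟩ := Finset.exists_subsuperset_card_eq
      (s := commonPosNeighbors B u v) (t := ({u, v} : Finset V)ᶜ) (n := s) (by
        intro z hz
        simp only [mem_compl, mem_insert, mem_singleton, not_or]
        exact ⟨fun e => hu (e ▸ hz), fun e => hv (e ▸ hz)⟩) hk (by
        rw [card_compl, card_pair hne]
        omega)
    have huW : u ∉ W := fun e => by simpa using hWsup e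
    have hvW : v ∉ W := fun e => by simpa using hWsup e
    have hH := pendantMatrix_isHermitian u v W
    have hκW := hκ u v W hne huW hvW hWs
    have hWc : ∀ w, B u w = 1 → B v w = 1 → w ∈ W := fun w h1 h2 =>
      hWsub (mem_commonPosNeighbors.2 ⟨h1, h2⟩)
    have h1 := dotProduct_mulVec_le_pendantMatrix hB huv hne W hx hle hWc
    have h2 := hH.dotProduct_mulVec_le x
    rw [hκW] at h2
    rw [hμx] at h1
    refine ⟨le_of_mul_le_mul_right (h1.trans h2) hxx, fun heq => ?_⟩
    subst heq
    have heq' := le_antisymm h2 h1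
    have heig := hH.mulVec_eq_of_dotProduct_mulVec_eq (x := x) (by rw [hκW, heq'])
    have hlt := lt_sSup_spectrum_pendantMatrix hne huW hvW (by omega)
    have hpos := pos_of_pendantMatrix_mulVec_eq hne huW hvW (by omega) hx hx0 (by linarith) heig
    refine ⟨u, v, W, hne, huW, hvW, hWs, ?_⟩
    refine eq_pendantMatrix_of_dotProduct_mulVec_eq hB huv hne W hpos hle hWc ?_
      (by rw [hμx, heq'])
    intro w hwu hwv hw
    exact lt_of_le_of_ne hle (ne_of_pendantMatrix_mulVec_eq hne huW hvW hpos heig hwu hwv hw)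
  · suffices μ < κ from ⟨this.le, fun e => absurd e this.ne⟩
    by_contra hcon
    have hpend : ∀ a ∈ commonPosNeighbors B u v, #(commonPosNeighbors B u v) = s + 1 →
        sSup (spectrum ℝ (pendantMatrix u v ((commonPosNeighbors B u v).erase a))) = κ := by
      intro a ha hc
      exact hκ u v _ hne (fun e => hu (mem_of_mem_erase e)) (fun e => hv (mem_of_mem_erase e))
        (by rw [card_erase_of_mem ha, hc, Nat.add_sub_cancel])
    -- Under the assumption `κ ≤ μ`, the lower bound for pendant matrices passes to `μ` and makes
    -- the count of nonpositive pairs available.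
    have hμn : (Fintype.card V : ℝ) - 2 < μ := by
      obtain ⟨W, hWsub, hWs⟩ := Finset.exists_subset_card_eq hk.le
      have huW : u ∉ W := fun e => hu (hWsub e)
      have hvW : v ∉ W := fun e => hv (hWsub e)
      have := lt_sSup_spectrum_pendantMatrix hne huW hvW (by omega)
      rw [hκ u v W hne huW hvW hWs] at this
      linarith
    obtain ⟨hc, hδ, hD⟩ := hB.structure_of_lt_card_commonPosNeighbors huv hne (by omega)
      (hB.sum_card_nonposNeighbors_le hx hx0 (by omega) hμn h) hk (hcount u v huv hk)
    have hcard : #(commonPosNeighbors B u v) + 2 ≤ Fintype.card V := by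
      rw [← card_pair hne, ← Finset.card_union_of_disjoint (by simp [hu, hv])]
      exact card_le_univ _
    obtain ⟨a, ha, hlt⟩ := hB.exists_two_mul_lt_sum hn hx hx0 hμn h hs (by omega) u hc hδ hD
    have h1 := hB.add_sum_le_pendantMatrix_erase huv hne hx hle hD ha
    have h2 := (pendantMatrix_isHermitian u v
      ((commonPosNeighbors B u v).erase a)).dotProduct_mulVec_le x
    rw [hpend a ha hc] at h2
    rw [hμx] at h1
    have h3 : μ * (x ⬝ᵥ x) < κ * (x ⬝ᵥ x) := by linarith
    exact hcon (lt_of_mul_lt_mul_right h3 hxx.le)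

end Extremal

/-! ### Signed graphs: switching, balance and copies of `K₄` -/

namespace SignedGraph

variable {V W : Type*}

theorem edgeSign_symm (Γ : SignedGraph V) {u v : V} (h : Γ.graph.Adj u v) (h' : Γ.graph.Adj v u) :
    Γ.edgeSign h' = Γ.edgeSign h := by
  unfold edgeSign
  congr 2
  exact Sym2.eq_swap

theorem adjMatrix_of_adj (Γ : SignedGraph V) {u v : V} (h : Γ.graph.Adj u v) :
    Γ.adjMatrix u v = ((Γ.edgeSign h : ℤ) : ℝ) := by
  simp [adjMatrix, h]

theorem adjMatrix_of_not_adj (Γ : SignedGraph V) {u v : V} (h : ¬ Γ.graph.Adj u v) :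
    Γ.adjMatrix u v = 0 := by
  simp [adjMatrix, h]

theorem adjMatrix_ne_zero_iff (Γ : SignedGraph V) {u v : V} :
    Γ.adjMatrix u v ≠ 0 ↔ Γ.graph.Adj u v := by
  by_cases h : Γ.graph.Adj u v
  · rw [adjMatrix_of_adj Γ h]
    simp [h]
  · simp [adjMatrix_of_not_adj Γ h, h]

theorem isSignMatrix_adjMatrix (Γ : SignedGraph V) : IsSignMatrix Γ.adjMatrix where
  symm u v := by
    by_cases h : Γ.graph.Adj u v
    · rw [adjMatrix_of_adj Γ h, adjMatrix_of_adj Γ h.symm, edgeSign_symm Γ h]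
    · rw [adjMatrix_of_not_adj Γ h, adjMatrix_of_not_adj Γ fun e => h e.symm]
  diag u := adjMatrix_of_not_adj Γ (Γ.graph.loopless.irrefl u)
  entries u v := by
    by_cases h : Γ.graph.Adj u v
    · rw [adjMatrix_of_adj Γ h]
      rcases Int.units_eq_one_or (Γ.edgeSign h) with e | e <;> rw [e] <;> simp
    · exact Or.inr (Or.inl (adjMatrix_of_not_adj Γ h))

theorem isHermitian_adjMatrix (Γ : SignedGraph V) : Γ.adjMatrix.IsHermitian := by
  ext i j
  simp [Γ.isSignMatrix_adjMatrix.symm j i]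

theorem isomorphic_of_adjMatrix {Γ : SignedGraph V} {Γ' : SignedGraph W} (f : V ≃ W)
    (h : ∀ u v, Γ'.adjMatrix (f u) (f v) = Γ.adjMatrix u v) : Γ.Isomorphic Γ' := by
  have hadj : ∀ u v, Γ'.graph.Adj (f u) (f v) ↔ Γ.graph.Adj u v := by
    intro u v
    rw [← adjMatrix_ne_zero_iff, ← adjMatrix_ne_zero_iff, h]
  refine ⟨⟨f, hadj _ _⟩, fun u v huv => ?_⟩
  have := h u v
  rw [adjMatrix_of_adj Γ huv, adjMatrix_of_adj Γ' ((hadj u v).2 huv)] at this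
  exact Units.ext (by exact_mod_cast this)

theorem Isomorphic.exists_adjMatrix {Γ : SignedGraph V} {Γ' : SignedGraph W}
    (h : Γ.Isomorphic Γ') : ∃ f : V ≃ W, ∀ u v, Γ'.adjMatrix (f u) (f v) = Γ.adjMatrix u v := by
  obtain ⟨f, hf⟩ := h
  refine ⟨f.toEquiv, fun u v => ?_⟩
  by_cases huv : Γ.graph.Adj u v
  · rw [adjMatrix_of_adj Γ huv, ← hf u v huv]
    exact adjMatrix_of_adj Γ' _
  · rw [adjMatrix_of_not_adj Γ huv]
    exact adjMatrix_of_not_adj Γ' fun e => huv (f.map_adj_iff.1 e)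

theorem sSup_spectrum_eq_of_equiv [Fintype V] [Fintype W] [DecidableEq V] [DecidableEq W]
    {A : Matrix V V ℝ} {B : Matrix W W ℝ} (f : V ≃ W) (h : ∀ u v, B (f u) (f v) = A u v) :
    sSup (spectrum ℝ A) = sSup (spectrum ℝ B) := by
  have : Matrix.reindexAlgEquiv ℝ ℝ f A = B := by
    ext i j
    simp [← h]
  rw [← this, AlgEquiv.spectrum_eq]

theorem index_eq [Fintype V] [DecidableEq V] (Γ : SignedGraph V) :
    Γ.index = sSup (spectrum ℝ Γ.adjMatrix) := by
  unfold index
  congr!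

theorem Isomorphic.index_eq [Fintype V] [Fintype W] {Γ : SignedGraph V} {Γ' : SignedGraph W}
    (h : Γ.Isomorphic Γ') : Γ.index = Γ'.index := by
  classical
  obtain ⟨f, hf⟩ := h.exists_adjMatrix
  rw [SignedGraph.index_eq, SignedGraph.index_eq]
  exact sSup_spectrum_eq_of_equiv f hf

theorem adjMatrix_switch (Γ : SignedGraph V) (θ : V → ℤˣ) (u v : V) :
    (Γ.switch {w | θ w = -1}).adjMatrix u v =
      ((θ u : ℤ) : ℝ) * ((θ v : ℤ) : ℝ) * Γ.adjMatrix u v := by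
  by_cases h : Γ.graph.Adj u v
  · rw [adjMatrix_of_adj Γ h, adjMatrix_of_adj (Γ.switch _) (u := u) (v := v) h]
    simp only [edgeSign, switch]
    rcases Int.units_eq_one_or (θ u) with e | e <;> rcases Int.units_eq_one_or (θ v) with e' | e' <;>
      simp [e, e']
  · rw [adjMatrix_of_not_adj Γ h, adjMatrix_of_not_adj (Γ.switch _) (u := u) (v := v) h, mul_zero]

/-- Switching is conjugation by a diagonal matrix of signs, which is its own inverse. -/
theorem spectrum_sign_conj [Fintype V] [DecidableEq V] (A : Matrix V V ℝ) (θ : V → ℤˣ) :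
    spectrum ℝ (Matrix.of fun u v => ((θ u : ℤ) : ℝ) * ((θ v : ℤ) : ℝ) * A u v) =
      spectrum ℝ A := by
  have hsq : ∀ u, ((θ u : ℤ) : ℝ) * ((θ u : ℤ) : ℝ) = 1 := by
    intro u
    rcases Int.units_eq_one_or (θ u) with e | e <;> simp [e]
  have hD : Matrix.diagonal (fun u => ((θ u : ℤ) : ℝ)) *
      Matrix.diagonal (fun u => ((θ u : ℤ) : ℝ)) = 1 := by
    rw [Matrix.diagonal_mul_diagonal]
    simp_rw [hsq]
    exact Matrix.diagonal_one
  let D : (Matrix V V ℝ)ˣ := ⟨_, _, hD, hD⟩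
  have : (Matrix.of fun u v => ((θ u : ℤ) : ℝ) * ((θ v : ℤ) : ℝ) * A u v) = D * A * D⁻¹ := by
    ext u v
    change _ = (Matrix.diagonal (fun u => ((θ u : ℤ) : ℝ)) * A *
      Matrix.diagonal (fun u => ((θ u : ℤ) : ℝ)) : Matrix V V ℝ) u v
    rw [Matrix.mul_diagonal, Matrix.diagonal_mul]
    simp only [Matrix.of_apply]
    ring
  rw [this, spectrum.units_conjugate]

theorem index_switch [Fintype V] (Γ : SignedGraph V) (U : Set V) :
    (Γ.switch U).index = Γ.index := by
  classical
  have hU : U = {w | (fun w => if w ∈ U then (-1 : ℤˣ) else 1) w = -1} := by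
    ext w
    by_cases h : w ∈ U <;> simp [h]
  rw [index_eq, index_eq, ← spectrum_sign_conj Γ.adjMatrix fun w => if w ∈ U then (-1 : ℤˣ) else 1]
  congr 2
  ext u v
  rw [hU, adjMatrix_switch, ← hU]
  rfl

theorem SwitchingEquivalent.index_eq [Fintype V] [Fintype W] {Γ : SignedGraph V}
    {Γ' : SignedGraph W} (h : Γ.SwitchingEquivalent Γ') : Γ.index = Γ'.index := by
  obtain ⟨Γ'', hsw, hiso⟩ := h
  rw [← hiso.index_eq]
  clear hiso
  induction hsw with
  | refl => rfl
  | tail _ hstep ih =>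
    obtain ⟨U, -, -, rfl⟩ := hstep
    rw [ih, index_switch]

theorem switchingEquivalent_of_adjMatrix {Γ : SignedGraph V} {Γ' : SignedGraph W} (θ : V → ℤˣ)
    (f : V ≃ W) (h : ∀ u v, Γ'.adjMatrix (f u) (f v) =
      ((θ u : ℤ) : ℝ) * ((θ v : ℤ) : ℝ) * Γ.adjMatrix u v) : Γ.SwitchingEquivalent Γ' := by
  -- A switching step needs a nonempty proper set. Otherwise `θ` is constant, the signs cancel, and
  -- no step is needed.
  by_cases hU : ({w | θ w = -1} : Set V).Nonempty ∧ ({w | θ w = -1} : Set V) ≠ Set.univ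
  · exact ⟨_, Relation.ReflTransGen.single ⟨_, hU.1, hU.2, rfl⟩,
      isomorphic_of_adjMatrix f fun u v => by rw [h, adjMatrix_switch]⟩
  · refine ⟨Γ, Relation.ReflTransGen.refl, isomorphic_of_adjMatrix f fun u v => ?_⟩
    rw [h]
    have hθ : θ u = θ v := by
      by_cases he : ({w | θ w = -1} : Set V).Nonempty
      · have huniv : ({w | θ w = -1} : Set V) = Set.univ := by
          by_contra hcon
          exact hU ⟨he, hcon⟩
        have : ∀ w, θ w = -1 := fun w => by
          have : w ∈ ({w | θ w = -1} : Set V) := huniv ▸ Set.mem_univ w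
          exact this
        rw [this, this]
      · have : ∀ w, θ w = 1 := fun w => (Int.units_eq_one_or (θ w)).resolve_right fun e =>
          he ⟨w, e⟩
        rw [this, this]
    rw [hθ]
    rcases Int.units_eq_one_or (θ v) with e | e <;> simp [e]

/-- The product of the edge signs along a walk telescopes. On a closed walk it equals `1`, so the
number of negative edges is even. -/
theorem neg_one_pow_negCount (Γ : SignedGraph V) (θ : V → ℤˣ)
    (h : ∀ u v (huv : Γ.graph.Adj u v), Γ.edgeSign huv = θ u * θ v) {u v : V}
    (p : Γ.graph.Walk u v) : (-1 : ℤˣ) ^ Γ.negCount p = θ u * θ v := by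
  induction p with
  | nil => simp [negCount, Int.units_mul_self]
  | @cons a b c hab q ih =>
    have hc : Γ.negCount (SimpleGraph.Walk.cons hab q) =
        Γ.negCount q + if Γ.edgeSign hab = -1 then 1 else 0 := by
      simp [negCount, List.countP_cons]
    have hs : (-1 : ℤˣ) ^ (if Γ.edgeSign hab = -1 then 1 else 0) = Γ.edgeSign hab := by
      rcases Int.units_eq_one_or (Γ.edgeSign hab) with e | e <;> simp [e]
    rw [hc, pow_add, hs, ih, h, mul_comm, mul_assoc, ← mul_assoc (θ b), Int.units_mul_self, one_mul]

/-- However an unbalanced signed graph is switched, it keeps a negative edge. -/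
theorem Unbalanced.exists_neg {Γ : SignedGraph V} (hΓ : Γ.Unbalanced) (θ : V → ℤˣ) :
    ∃ u v, ((θ u : ℤ) : ℝ) * ((θ v : ℤ) : ℝ) * Γ.adjMatrix u v = -1 := by
  by_contra! hcon
  refine hΓ fun u c _ => ?_
  have hsign : ∀ u v (huv : Γ.graph.Adj u v), Γ.edgeSign huv = θ u * θ v := by
    intro u v huv
    have := hcon u v
    rw [adjMatrix_of_adj Γ huv] at this
    rcases Int.units_eq_one_or (θ u) with e | e <;> rcases Int.units_eq_one_or (θ v) with e' | e' <;>
      rcases Int.units_eq_one_or (Γ.edgeSign huv) with e'' | e'' <;> simp [e, e', e''] at this ⊢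
  have := neg_one_pow_negCount Γ θ hsign c
  rw [Int.units_mul_self] at this
  exact (neg_one_pow_eq_one_iff_even (by decide)).1 this

theorem unbalanced_of_triangle (Γ : SignedGraph V) {u v w : V}
    (h : Γ.adjMatrix u v * Γ.adjMatrix v w * Γ.adjMatrix w u = -1) : Γ.Unbalanced := by
  have huv : Γ.graph.Adj u v := Γ.adjMatrix_ne_zero_iff.1 fun e => by simp [e] at h
  have hvw : Γ.graph.Adj v w := Γ.adjMatrix_ne_zero_iff.1 fun e => by simp [e] at h
  have hwu : Γ.graph.Adj w u := Γ.adjMatrix_ne_zero_iff.1 fun e => by simp [e] at h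
  intro hbal
  have hcyc : (SimpleGraph.Walk.cons huv
      (SimpleGraph.Walk.cons hvw (SimpleGraph.Walk.cons hwu SimpleGraph.Walk.nil))).IsCycle := by
    rw [SimpleGraph.Walk.cons_isCycle_iff]
    simp [huv.ne, huv.ne', hvw.ne, hwu.ne, hwu.ne']
  have := hbal u _ hcyc
  rw [adjMatrix_of_adj Γ huv, adjMatrix_of_adj Γ hvw, adjMatrix_of_adj Γ hwu] at h
  have hcount : Γ.negCount (SimpleGraph.Walk.cons huv
      (SimpleGraph.Walk.cons hvw (SimpleGraph.Walk.cons hwu SimpleGraph.Walk.nil))) =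
      (if Γ.edgeSign hwu = -1 then 1 else 0) + (if Γ.edgeSign hvw = -1 then 1 else 0) +
        (if Γ.edgeSign huv = -1 then 1 else 0) := by
    simp [negCount, List.countP_cons]
  rw [hcount] at this
  rcases Int.units_eq_one_or (Γ.edgeSign huv) with e | e <;>
    rcases Int.units_eq_one_or (Γ.edgeSign hvw) with e' | e' <;>
    rcases Int.units_eq_one_or (Γ.edgeSign hwu) with e'' | e'' <;>
    rw [e, e', e''] at h this <;> revert h this <;> norm_num

/-- A `t𝒦₄⁻`-free signed graph has fewer than `t` copies of `K₄` with a negative triangle. -/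
theorem UnbalancedK4Free.card_lt {Γ : SignedGraph V} {t : ℕ} (hΓ : Γ.UnbalancedK4Free t)
    (𝒮 : Finset (Finset V)) (h𝒮 : ∀ S ∈ 𝒮, Γ.graph.IsNClique 4 S ∧ ∃ u ∈ S, ∃ v ∈ S, ∃ w ∈ S,
      Γ.adjMatrix u v * Γ.adjMatrix v w * Γ.adjMatrix w u = -1) : #𝒮 < t := by
  classical
  by_contra! hcon
  obtain ⟨𝒯, h𝒯𝒮, h𝒯⟩ := Finset.exists_subset_card_eq hcon
  set X : Finset V := 𝒯.biUnion id with hX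
  let φ : Fin #X → V := fun a => X.equivFin.symm a
  have hφ : Function.Injective φ := fun a b hab =>
    X.equivFin.symm.injective (Subtype.ext hab)
  have hmem : ∀ S ∈ 𝒯, ∀ z ∈ S, ∃ a, φ a = z := fun S hS z hz =>
    ⟨X.equivFin ⟨z, mem_biUnion.2 ⟨S, hS, hz⟩⟩, by simp [φ]⟩
  -- Only edges inside a chosen clique are kept, because a member of the family has no edge outside
  -- its copies of `K₄`.
  let G : SimpleGraph (Fin #X) :=
    { Adj := fun a b => a ≠ b ∧ ∃ S ∈ 𝒯, φ a ∈ S ∧ φ b ∈ S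
      symm := ⟨fun a b h => ⟨h.1.symm, h.2.imp fun S hS => ⟨hS.1, hS.2.2, hS.2.1⟩⟩⟩
      loopless := ⟨fun a h => h.1 rfl⟩ }
  have hadj : ∀ {a b}, G.Adj a b → Γ.graph.Adj (φ a) (φ b) := by
    rintro a b ⟨hab, S, hS, ha, hb⟩
    exact (h𝒮 S (h𝒯𝒮 hS)).1.1 ha hb fun e => hab (hφ e)
  let F : G →g Γ.graph := ⟨φ, hadj⟩
  let H : SignedGraph (Fin #X) := ⟨G, fun e => Γ.sign (F.mapEdgeSet e)⟩
  have hHΓ : Γ.Contains H := ⟨F, hφ, fun a b h => rfl⟩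
  have hHadj : ∀ {a b}, H.graph.Adj a b → H.adjMatrix a b = Γ.adjMatrix (φ a) (φ b) := by
    intro a b h
    rw [adjMatrix_of_adj H h, adjMatrix_of_adj Γ (hadj h)]
    rfl
  let pre : Finset V → Finset (Fin #X) := fun S => {a | φ a ∈ S}
  have hpre : ∀ S ∈ 𝒯, (pre S).image φ = S := by
    intro S hS
    ext z
    simp only [pre, mem_image, mem_filter, mem_univ, true_and]
    refine ⟨?_, fun hz => ?_⟩
    · rintro ⟨a, ha, rfl⟩
      exact ha
    · obtain ⟨a, rfl⟩ := hmem S hS z hz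
      exact ⟨a, hz, rfl⟩
  refine hΓ _ H ⟨𝒯.image pre, ?_, ?_, ?_, ?_⟩ hHΓ
  · rw [Finset.card_image_of_injOn, h𝒯]
    intro S hS S' hS' h
    rw [← hpre S hS, ← hpre S' hS']
    exact congrArg _ h
  · intro S' hS'
    obtain ⟨S, hS, rfl⟩ := mem_image.1 hS'
    obtain ⟨hcl, u, hu, v, hv, w, hw, huvw⟩ := h𝒮 S (h𝒯𝒮 hS)
    have hclH : H.graph.IsClique (pre S : Set (Fin #X)) := by
      intro a ha b hb hab
      simp only [pre, coe_filter, mem_univ, true_and, Set.mem_ofPred_eq] at ha hb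
      exact ⟨hab, S, hS, ha, hb⟩
    refine ⟨⟨hclH, ?_⟩, ?_⟩
    · rw [← hcl.2]
      conv_rhs => rw [← hpre S hS]
      rw [Finset.card_image_of_injective _ hφ]
    · obtain ⟨a, rfl⟩ := hmem S hS u hu
      obtain ⟨b, rfl⟩ := hmem S hS v hv
      obtain ⟨c, rfl⟩ := hmem S hS w hw
      have ha : a ∈ (pre S : Set (Fin #X)) := by simpa [pre] using hu
      have hb : b ∈ (pre S : Set (Fin #X)) := by simpa [pre] using hv
      have hc : c ∈ (pre S : Set (Fin #X)) := by simpa [pre] using hw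
      have key : ∀ a b (ha : a ∈ (pre S : Set (Fin #X))) (hb : b ∈ (pre S : Set (Fin #X))),
          (H.induce (pre S : Set (Fin #X))).adjMatrix ⟨a, ha⟩ ⟨b, hb⟩ =
            Γ.adjMatrix (φ a) (φ b) := by
        intro a b ha hb
        by_cases hab : a = b
        · subst hab
          rw [(isSignMatrix_adjMatrix _).diag, Γ.isSignMatrix_adjMatrix.diag]
        · rw [← hHadj (hclH ha hb hab), adjMatrix_of_adj H (hclH ha hb hab)]
          exact adjMatrix_of_adj (H.induce _) (u := ⟨a, ha⟩) (v := ⟨b, hb⟩) (hclH ha hb hab)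
      refine unbalanced_of_triangle _ (u := ⟨a, ha⟩) (v := ⟨b, hb⟩) (w := ⟨c, hc⟩) ?_
      rw [key, key, key, huvw]
  · intro a
    have : φ a ∈ X := (X.equivFin.symm a).2
    obtain ⟨S, hS, ha⟩ := mem_biUnion.1 this
    exact ⟨pre S, mem_image_of_mem _ hS, by simpa [pre] using ha⟩
  · rintro a b ⟨-, S, hS, ha, hb⟩
    exact ⟨pre S, mem_image_of_mem _ hS, by simpa [pre] using ha, by simpa [pre] using hb⟩

end SignedGraph

/-! ### The index bound for signed graphs -/

namespace SignedGraph

variable {V : Type*} [Fintype V]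

/-- Switching at the vertices where an eigenvector of the index is negative replaces it by its
coordinatewise absolute value and keeps the eigenvalue. -/
theorem index_switch_eigenvector (Γ : SignedGraph V) [Nonempty V] : ∃ (θ : V → ℤˣ) (x : V → ℝ),
    0 ≤ x ∧ x ≠ 0 ∧ (Γ.switch {w | θ w = -1}).adjMatrix *ᵥ x = Γ.index • x := by
  classical
  obtain ⟨x, hx0, hx⟩ := Γ.isHermitian_adjMatrix.exists_mulVec_eq_sSup_spectrum_smul
  rw [← index_eq] at hx
  let θ : V → ℤˣ := fun i => if 0 ≤ x i then 1 else -1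
  have hθ : ∀ i, ((θ i : ℤ) : ℝ) * x i = |x i| := by
    intro i
    by_cases h : 0 ≤ x i
    · simp [θ, h, abs_of_nonneg h]
    · simp [θ, h, abs_of_neg (not_le.1 h)]
  refine ⟨θ, fun i => |x i|, fun i => abs_nonneg _, fun h => hx0 ?_, ?_⟩
  · ext i
    simpa using congrFun h i
  · ext i
    have hi := congrFun hx i
    simp only [mulVec, dotProduct, Pi.smul_apply, smul_eq_mul] at hi ⊢
    rw [← hθ i, mul_left_comm, ← hi, Finset.mul_sum]
    refine Finset.sum_congr rfl fun j _ => ?_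
    rw [adjMatrix_switch, ← hθ j]
    rcases Int.units_eq_one_or (θ j) with e | e <;> simp [e] <;> ring

/-- The pairs of adjacent common positive neighbours of the ends of a negative edge give distinct
unbalanced copies of `K₄`. -/
theorem UnbalancedK4Free.card_commonPosNeighbors_le [DecidableEq V] {Γ : SignedGraph V} {t : ℕ}
    (hΓ : Γ.UnbalancedK4Free t) (θ : V → ℤˣ) {B : Matrix V V ℝ}
    (hBθ : ∀ u v, B u v = ((θ u : ℤ) : ℝ) * ((θ v : ℤ) : ℝ) * Γ.adjMatrix u v) {u v : V}
    (huv : B u v = -1) :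
    #(commonPosNeighbors B u v) * (#(commonPosNeighbors B u v) - 1) ≤ 2 * (t - 1) +
      ∑ w ∈ commonPosNeighbors B u v, #{z ∈ commonPosNeighbors B u v | z ≠ w ∧ B w z = 0} := by
  classical
  have hadj : ∀ a b, B a b ≠ 0 ↔ Γ.graph.Adj a b := by
    intro a b
    rw [hBθ, ← adjMatrix_ne_zero_iff]
    simp
  set W := commonPosNeighbors B u v with hW
  have hWu : ∀ w ∈ W, Γ.graph.Adj w u := fun w hw => by
    refine ((hadj u w).1 ?_).symm
    rw [(mem_commonPosNeighbors.1 hw).1]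
    norm_num
  have hWv : ∀ w ∈ W, Γ.graph.Adj w v := fun w hw => by
    refine ((hadj v w).1 ?_).symm
    rw [(mem_commonPosNeighbors.1 hw).2]
    norm_num
  have hadjuv : Γ.graph.Adj u v := (hadj u v).1 (by rw [huv]; norm_num)
  let G : SimpleGraph V :=
    { Adj := fun a b => a ∈ W ∧ b ∈ W ∧ Γ.graph.Adj a b
      symm := ⟨fun a b h => ⟨h.2.1, h.1, h.2.2.symm⟩⟩
      loopless := ⟨fun a h => Γ.graph.loopless.irrefl a h.2.2⟩ }
  have hmemW : ∀ e ∈ G.edgeFinset, ∀ z ∈ e, z ∈ W := by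
    intro e he z hz
    induction e with
    | h a b =>
      rw [SimpleGraph.mem_edgeFinset, SimpleGraph.mem_edgeSet] at he
      rcases Sym2.mem_iff.1 hz with rfl | rfl
      · exact he.1
      · exact he.2.1
  have hcard : #(G.edgeFinset.image fun e => e.toFinset ∪ {u, v}) = #G.edgeFinset := by
    refine Finset.card_image_of_injOn ?_
    -- Since `u` and `v` are not in `W`, an edge is recovered as the intersection of its 4-set with
    -- `W`; distinct edges therefore give distinct copies.
    have hmem : ∀ e ∈ G.edgeFinset, ∀ z, z ∈ e ↔ z ∈ e.toFinset ∪ {u, v} ∧ z ∈ W := by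
      intro e he z
      rw [mem_union, Sym2.mem_toFinset, mem_insert, mem_singleton]
      refine ⟨fun hz => ⟨Or.inl hz, hmemW e he z hz⟩, ?_⟩
      rintro ⟨hz | rfl | rfl, hzW⟩
      · exact hz
      · exact absurd (hWu z hzW) (Γ.graph.loopless.irrefl z)
      · exact absurd (hWv z hzW) (Γ.graph.loopless.irrefl z)
    intro e he e' he' h
    refine Sym2.ext fun z => ?_
    rw [hmem e he, hmem e' he']
    exact and_congr_left' (by rw [show e.toFinset ∪ {u, v} = e'.toFinset ∪ {u, v} from h])
  have hlt := hΓ.card_lt (G.edgeFinset.image fun e => e.toFinset ∪ {u, v}) (by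
    intro S hS
    obtain ⟨e, he, rfl⟩ := mem_image.1 hS
    induction e with
    | h a b =>
      rw [SimpleGraph.mem_edgeFinset, SimpleGraph.mem_edgeSet] at he
      obtain ⟨ha, hb, hab⟩ := he
      have hset : s(a, b).toFinset ∪ {u, v} = insert a (insert b ({u, v} : Finset V)) := by
        rw [Sym2.toFinset_mk_eq]
        ext z
        simp only [mem_union, mem_insert, mem_singleton]
        tauto
      simp only [hset]
      refine ⟨?_, u, by simp, v, by simp, a, by simp, ?_⟩
      · have h1 : Γ.graph.IsNClique 2 ({u, v} : Finset V) :=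
          (SimpleGraph.isNClique_one.2 ⟨v, rfl⟩ : Γ.graph.IsNClique 1 {v}).insert
            (by simpa using hadjuv)
        refine (h1.insert (a := b) ?_).insert ?_
        · simpa using ⟨hWu b hb, hWv b hb⟩
        · simpa using ⟨hab, hWu a ha, hWv a ha⟩
      · have ha' := mem_commonPosNeighbors.1 ha
        rw [hBθ, hBθ] at ha'
        rw [hBθ] at huv
        rw [Γ.isSignMatrix_adjMatrix.symm a u]
        have hprod := congrArg₂ (· * ·) (congrArg₂ (· * ·) huv ha'.2) ha'.1
        have hsq : ∀ z, ((θ z : ℤ) : ℝ) * ((θ z : ℤ) : ℝ) = 1 := fun z => by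
          rcases Int.units_eq_one_or (θ z) with e | e <;> simp [e]
        calc Γ.adjMatrix u v * Γ.adjMatrix v a * Γ.adjMatrix u a
            = (((θ u : ℤ) : ℝ) * ((θ u : ℤ) : ℝ)) * (((θ v : ℤ) : ℝ) * ((θ v : ℤ) : ℝ)) *
              (((θ a : ℤ) : ℝ) * ((θ a : ℤ) : ℝ)) *
              (Γ.adjMatrix u v * Γ.adjMatrix v a * Γ.adjMatrix u a) := by
              rw [hsq, hsq, hsq]
              ring
          _ = -1 * 1 * 1 := by
              rw [← hprod]
              ring
          _ = -1 := by norm_num)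
  rw [hcard] at hlt
  have hdeg : ∀ w ∈ W, G.degree w + #{z ∈ W | z ≠ w ∧ B w z = 0} = #W - 1 := by
    intro w hw
    rw [← card_erase_of_mem hw, ← SimpleGraph.card_neighborFinset_eq_degree,
      ← Finset.card_filter_add_card_filter_not (s := W.erase w) (fun z => B w z ≠ 0)]
    congr 2
    · ext z
      simp only [SimpleGraph.mem_neighborFinset, mem_filter, mem_erase, hadj]
      exact ⟨fun h => ⟨⟨h.2.2.ne', h.2.1⟩, h.2.2⟩, fun h => ⟨hw, h.1.2, h.2⟩⟩
    · ext z
      simp only [mem_filter, mem_erase, not_not]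
      tauto
  have hsum : ∑ w ∈ W, G.degree w = 2 * #G.edgeFinset := by
    rw [← G.sum_degrees_eq_twice_card_edges]
    refine Finset.sum_subset (subset_univ _) fun w _ hw => ?_
    rw [← SimpleGraph.card_neighborFinset_eq_degree, Finset.card_eq_zero,
      Finset.eq_empty_iff_forall_notMem]
    intro z hz
    rw [SimpleGraph.mem_neighborFinset] at hz
    exact hw hz.1
  -- Ordered pairs of distinct vertices of `W` are split into adjacent and nonadjacent ones; the
  -- adjacent ones number twice the edges, and there are at most `t - 1` edges.
  have htotal : #W * (#W - 1) = ∑ w ∈ W, (G.degree w + #{z ∈ W | z ≠ w ∧ B w z = 0}) := by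
    rw [Finset.sum_congr rfl hdeg]
    simp
  rw [htotal, Finset.sum_add_distrib, hsum]
  omega

theorem extremal_adjMatrix_apply (s n : ℕ) (i j : Fin n) :
    (extremal s n).adjMatrix i j =
      if i ≠ j ∧ (i.val + 1 = n → j.val ≤ s) ∧ (j.val + 1 = n → i.val ≤ s) then
        if (i.val = 0 ∨ j.val = 0) ∧ (i.val + 1 = n ∨ j.val + 1 = n) then -1 else 1
      else 0 := by
  by_cases h : i ≠ j ∧ (i.val + 1 = n → j.val ≤ s) ∧ (j.val + 1 = n → i.val ≤ s)
  · rw [adjMatrix_of_adj (extremal s n) (u := i) (v := j) h, if_pos h]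
    simp only [edgeSign, extremal, Sym2.mem_iff, exists_eq_or_imp, exists_eq_left]
    split_ifs <;> simp
  · rw [adjMatrix_of_not_adj (extremal s n) (u := i) (v := j) h, if_neg h]

theorem exists_equiv_extremal [DecidableEq V] {s n : ℕ} (hn : Fintype.card V = n)
    (hsn : s + 2 ≤ n) {u v : V} {W : Finset V} (hne : u ≠ v) (hu : u ∉ W) (hv : v ∉ W)
    (hW : #W = s) : ∃ f : V ≃ Fin n, ∀ i j,
      (extremal s n).adjMatrix (f i) (f j) = pendantMatrix u v W i j := by
  subst hW
  let e := W.equivFin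
  have heu : ∀ k, (e.symm k : V) ≠ u := fun k h => hu (h ▸ (e.symm k).2)
  have hev : ∀ k, (e.symm k : V) ≠ v := fun k h => hv (h ▸ (e.symm k).2)
  -- The labelling is prescribed only at `0` (giving `v`), at `1, …, #W` (giving `W`) and at `n - 1`
  -- (giving `u`). Elsewhere `u` is a default value, and the bijection is an arbitrary extension.
  let φ : Fin n → V := fun i =>
    if i.val = 0 then v
    else if h : i.val - 1 < #W then e.symm ⟨i.val - 1, h⟩
    else u
  obtain ⟨g, hg⟩ := Finset.exists_equiv_extend_of_card_eq (α := Fin n) (t := (univ : Finset V))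
    (by simp [hn]) (s := ({i | i.val ≤ #W ∨ i.val + 1 = n} : Finset (Fin n))) (f := φ)
    (subset_univ _) (by
      intro i hi j hj hij
      simp only [coe_filter, mem_univ, true_and, Set.mem_ofPred_eq] at hi hj
      simp only [φ] at hij
      split_ifs at hij
      all_goals first
        | exact absurd hij hne
        | exact absurd hij.symm hne
        | exact absurd hij (hev _)
        | exact absurd hij.symm (hev _)
        | exact absurd hij (heu _)
        | exact absurd hij.symm (heu _)
        | (ext; omega)
        | (have := e.symm.injective (Subtype.ext hij)
           simp only [Fin.mk.injEq] at this
           ext; omega))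
  let k : Fin n ≃ V := g.trans (Equiv.subtypeUnivEquiv fun _ => mem_univ _)
  have hk : ∀ i : Fin n, i.val ≤ #W ∨ i.val + 1 = n → k i = φ i := fun i hi =>
    hg i (by simpa using hi)
  have hkv : ∀ i : Fin n, k i = v ↔ i.val = 0 := by
    have h0 : k ⟨0, by omega⟩ = v := by
      rw [hk _ (by simp)]
      simp [φ]
    intro i
    rw [← h0, k.apply_eq_iff_eq, Fin.ext_iff]
  have hku : ∀ i : Fin n, k i = u ↔ i.val + 1 = n := by
    have h0 : k ⟨n - 1, by omega⟩ = u := by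
      rw [hk _ (Or.inr (by simp only; omega))]
      simp only [φ]
      rw [if_neg (by omega), dif_neg (by omega)]
    intro i
    rw [← h0, k.apply_eq_iff_eq, Fin.ext_iff]
    simp only
    omega
  have hkW : ∀ i : Fin n, k i ∈ W ↔ 1 ≤ i.val ∧ i.val ≤ #W := by
    intro i
    constructor
    · intro hi
      have hj : k ⟨(e ⟨k i, hi⟩).val + 1, by omega⟩ = k i := by
        rw [hk _ (Or.inl (by simp only; omega))]
        simp [φ]
      rw [k.apply_eq_iff_eq, Fin.ext_iff] at hj
      simp only at hj
      omega
    · intro hi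
      rw [hk i (Or.inl hi.2)]
      simp only [φ]
      rw [if_neg (by omega), dif_pos (by omega)]
      exact (e.symm _).2
  refine ⟨k.symm, fun a b => ?_⟩
  obtain ⟨i, rfl⟩ := k.surjective a
  obtain ⟨j, rfl⟩ := k.surjective b
  rw [k.symm_apply_apply, k.symm_apply_apply, extremal_adjMatrix_apply]
  simp only [pendantMatrix, Matrix.of_apply, k.apply_eq_iff_eq, hkv, hku, hkW]
  have hi := i.isLt
  have hj := j.isLt
  by_cases hij : i = j
  · simp [hij]
  have hij' : i.val ≠ j.val := fun h => hij (Fin.ext h)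
  simp only [hij, ne_eq, not_false_eq_true, true_and, if_false]
  split_ifs <;> first | rfl | (exfalso; omega)

/-- The bound on the index and the case of equality, for a signed graph whose ends of negative
edges have, after any switching, either at most `s` common positive neighbours or few adjacent
pairs of them. -/
theorem Unbalanced.index_le_extremal {Γ : SignedGraph V} (hΓ : Γ.Unbalanced) {s n : ℕ}
    (hn : Fintype.card V = n) (hn9 : 9 ≤ n) (hs : 2 ≤ s) (hsn : s + 2 ≤ n)
    (hfree : s + 2 = n ∨ ∃ t, 2 * (t - 1) = s * (s - 1) ∧ Γ.UnbalancedK4Free t) :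
    Γ.index ≤ (extremal s n).index ∧
      (Γ.index = (extremal s n).index ↔ Γ.SwitchingEquivalent (extremal s n)) := by
  classical
  have : Nonempty V := Fintype.card_pos_iff.1 (by omega)
  obtain ⟨θ, x, hx, hx0, heig⟩ := Γ.index_switch_eigenvector
  have hB := (Γ.switch {w | θ w = -1}).isSignMatrix_adjMatrix
  have hBθ := Γ.adjMatrix_switch θ
  obtain ⟨u, v, huv⟩ := hΓ.exists_neg θ
  rw [← hBθ] at huv
  have hmain := hB.eigenvalue_le (by omega) hx hx0 heig huv hs (by omega) (κ := (extremal s n).index)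
    (by
      intro a b hab hlt
      rcases hfree with h | ⟨t, ht, hfree⟩
      · exfalso
        have hcard := Finset.card_le_card (t := ({a, b} : Finset V)ᶜ)
          (s := commonPosNeighbors (Γ.switch {w | θ w = -1}).adjMatrix a b) (by
            intro z hz
            simp only [mem_compl, mem_insert, mem_singleton, not_or]
            exact ⟨fun e => hB.left_notMem_commonPosNeighbors a b (e ▸ hz),
              fun e => hB.right_notMem_commonPosNeighbors a b (e ▸ hz)⟩)
        have hne : a ≠ b := by
          rintro rfl
          rw [hB.diag] at hab
          norm_num at hab
        rw [card_compl, card_pair hne] at hcard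
        omega
      · rw [← ht]
        exact hfree.card_commonPosNeighbors_le θ hBθ hab)
    (by
      intro a b W hab ha hb hW
      obtain ⟨f, hf⟩ := exists_equiv_extremal hn hsn hab ha hb hW
      rw [index_eq]
      exact sSup_spectrum_eq_of_equiv f hf)
  refine ⟨hmain.1, fun heq => ?_, fun h => h.index_eq⟩
  obtain ⟨a, b, W, hab, ha, hb, hW, hBW⟩ := hmain.2 heq
  obtain ⟨f, hf⟩ := exists_equiv_extremal hn hsn hab ha hb hW
  exact switchingEquivalent_of_adjMatrix θ f fun i j => by rw [hf, ← hBW, hBθ]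

end SignedGraph

/-! ### The parameter `r` and the conclusion -/

theorem two_mul_pred_eq_of_eq_sqrt {t r : ℕ} (ht : 2 ≤ t)
    (hr : (r : ℝ) = (1 + √(8 * (t : ℝ) - 7)) / 2) : 2 ≤ r ∧ 2 * (t - 1) = r * (r - 1) := by
  have ht' : (2 : ℝ) ≤ t := by exact_mod_cast ht
  have hsqrt : √(8 * (t : ℝ) - 7) = 2 * r - 1 := by linarith
  have hsq := Real.sq_sqrt (show (0 : ℝ) ≤ 8 * (t : ℝ) - 7 by linarith)
  have hnonneg := Real.sqrt_nonneg (8 * (t : ℝ) - 7)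
  rw [hsqrt] at hsq hnonneg
  have hr2 : 2 ≤ r := by
    by_contra hcon
    have : (r : ℝ) ≤ 1 := by exact_mod_cast (by omega : r ≤ 1)
    nlinarith
  refine ⟨hr2, ?_⟩
  obtain ⟨q, rfl⟩ : ∃ q, r = q + 1 := ⟨r - 1, by omega⟩
  obtain ⟨p, rfl⟩ : ∃ p, t = p + 1 := ⟨t - 1, by omega⟩
  push_cast at hsq
  have : (2 * p : ℝ) = (q + 1) * q := by nlinarith
  simp only [Nat.add_sub_cancel]
  exact_mod_cast this

theorem mainTheorem1 :
    ∃ N : ℕ, ∀ n : ℕ, N ≤ n → ∀ t r : ℕ, 2 ≤ t → (r : ℝ) = (1 + √(8 * (t : ℝ) - 7)) / 2 →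
      ∀ (V : Type*) [Fintype V], Fintype.card V = n →
        ∀ Γ : SignedGraph V, Γ.Unbalanced → Γ.UnbalancedK4Free t →
          (t ≤ (n - 2).choose 2 →
            Γ.index ≤ (SignedGraph.extremal r n).index ∧
            (Γ.index = (SignedGraph.extremal r n).index ↔
              Γ.SwitchingEquivalent (SignedGraph.extremal r n))) ∧
          ((n - 2).choose 2 + 1 ≤ t →
            Γ.index ≤ (SignedGraph.extremal (n - 2) n).index ∧
            (Γ.index = (SignedGraph.extremal (n - 2) n).index ↔
              Γ.SwitchingEquivalent (SignedGraph.extremal (n - 2) n))) := by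
  refine ⟨9, fun n hn t r ht hr V _ hV Γ hΓ hfree => ?_⟩
  obtain ⟨hr2, htr⟩ := two_mul_pred_eq_of_eq_sqrt ht hr
  have hchoose : (n - 2).choose 2 * 2 = (n - 2) * (n - 2 - 1) := by
    rw [Nat.choose_two_right]
    exact Nat.div_mul_cancel (Nat.even_mul_pred_self _).two_dvd
  refine ⟨fun hle => ?_, fun _ => ?_⟩
  -- If `r ≥ n - 2`, then `2(t - 1) = r(r - 1) ≥ (n - 2)(n - 3) ≥ 2t`, which is absurd.
  · have hrn : r < n - 2 := by
      by_contra hcon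
      have h1 : (n - 2) * (n - 2 - 1) ≤ r * (r - 1) := Nat.mul_le_mul (by omega) (by omega)
      omega
    exact hΓ.index_le_extremal hV hn hr2 (by omega) (Or.inr ⟨t, htr, hfree⟩)
  · exact hΓ.index_le_extremal hV hn (by omega) (by omega) (Or.inl (by omega))
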